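/- **Setting.** Let $\tau\in(0,1)$, $\rho_\tau(u)=\tfrac12u^2|\tau-I(u<0)|$, and let $(\boldsymbol x_{ti},y_{ti})\in\mathbb R^p\times\mathbb R$ ($t,i\ge1$) be i.i.d. observations; batch $t$ consists of the observations $i=1,\dots,n_t$, $n_t\ge1$. Put $$\mathcal L_{n_t}(\boldsymbol\beta)=\frac1{n_t}\sum_{i=1}^{n_t}\rho_\tau(y_{ti}-\boldsymbol x_{ti}^\top\boldsymbol\beta),\quad W_{n_t}(\boldsymbol\beta)=\sum_{i=1}^{n_t}|\tau-I(y_{ti}<\boldsymbol x_{ti}^\top\boldsymbol\beta)|\,\boldsymbol x_{ti}\boldsymbol x_{ti}^\top,\quad U_{n_t}(\boldsymbol\beta)=\sum_{i=1}^{n_t}|\tau-I(y_{ti}<\boldsymbol x_{ti}^\top\boldsymbol\beta)|\,\boldsymbol x_{ti}y_{ti}.$$ The renewable estimator starts from a minimizer $\tilde{\boldsymbol\beta}_1$ of $\mathcal L_{n_1}$ over $\mathbb R^p$, and for $b\ge2$ it is updated by $$\tilde{\boldsymbol\beta}_b=\Big[\sum_{t=1}^{b-1}W_{n_t}(\tilde{\boldsymbol\beta}_t)+W_{n_b}(\tilde{\boldsymbol\beta}_{b-1})\Big]^{-1}\Big[\sum_{t=1}^{b-1}W_{n_t}(\tilde{\boldsymbol\beta}_t)\,\tilde{\boldsymbol\beta}_{b-1}+U_{n_b}(\tilde{\boldsymbol\beta}_{b-1})\Big].\tag{E}$$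 Its fully optimized form has the same $\tilde{\boldsymbol\beta}_1$, and for $b\ge2$ takes $\tilde{\boldsymbol\beta}_b$ to be a minimizer over $\boldsymbol\beta\in\mathbb R^p$ of $$\frac1{N_b}\Big\{\tfrac12(\boldsymbol\beta-\tilde{\boldsymbol\beta}_{b-1})^\top\Big[\sum_{t=1}^{b-1}W_{n_t}(\tilde{\boldsymbol\beta}_t)\Big](\boldsymbol\beta-\tilde{\boldsymbol\beta}_{b-1})+n_b\,\mathcal L_{n_b}(\boldsymbol\beta)\Big\},\qquad N_b=\sum_{t=1}^b n_t.\tag{M}$$ **Conditions.** There are constants $c_1,\dots,c_4$ such that, for all $t,i$: * (C1) $\boldsymbol\beta_0$ lies in the interior of a compact convex set $\mathcal H\subset\mathbb R^p$. * (C2) The error $\epsilon_{ti}=y_{ti}-\boldsymbol x_{ti}^\top\boldsymbol\beta_0$ has, for almost every $\boldsymbol x$, conditional $\tau$-expectile $0$ given $\boldsymbol x_{ti}=\boldsymbol x$, i.e. $0$ minimizes $\theta\mapsto E[\rho_\tau(\epsilon_{ti}-\theta)\mid\boldsymbol x_{ti}=\boldsymbol x]$, and $E[\epsilon_{ti}^2\mid\boldsymbol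 x_{ti}=\boldsymbol x]\le c_1$. * (C3) Every eigenvalue of $\boldsymbol\Sigma=E[\boldsymbol x_{ti}\boldsymbol x_{ti}^\top]$ lies in $(0,c_2]$. * (C4) For almost every $\boldsymbol x$, $\epsilon_{ti}$ has given $\boldsymbol x_{ti}=\boldsymbol x$ a conditional density $f$ with $0<f\le c_3$. * (C5) $\|\boldsymbol x_{ti}\|<c_4$ almost surely, and $n_1\to\infty$. The sizes $n_t\ge1$ of the later batches are arbitrary and may change as $n_1$ grows. **Theorem 1 (consistency of the renewable estimator).** Under (C1)–(C5), $\tilde{\boldsymbol\beta}_b\xrightarrow{p}\boldsymbol\beta_0$ as $n_1\to\infty$, where the batch number $b\ge1$ may be fixed or may vary arbitrarily (in particular tend to infinity) as $n_1\to\infty$. This holds for the estimator computed by (E) and for its fully optimized form (M). -/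

import Mathlib

open MeasureTheory ProbabilityTheory Filter Topology
open scoped Matrix

namespace ReER

/-- The asymmetric weight `|τ - 1(u < 0)|`. -/
noncomputable def weight (τ u : ℝ) : ℝ := |τ - (if u < 0 then 1 else 0)|

/-- The asymmetric squared loss `ρ_τ(u) = (1/2) u² |τ - 1(u < 0)|`. -/
noncomputable def rho (τ u : ℝ) : ℝ := 1 / 2 * u ^ 2 * weight τ u

/-- `m` is a `τ`-expectile of the law `ν`: it minimises `θ ↦ E ρ_τ(Z - θ)`, `Z ∼ ν`.
It is used below only for laws with a finite second moment. -/
def IsExpectile (τ : ℝ) (ν : Measure ℝ) (m : ℝ) : Prop :=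
  ∀ θ : ℝ, ∫ e, rho τ (e - m) ∂ν ≤ ∫ e, rho τ (e - θ) ∂ν

variable {p : ℕ}

/-- The loss `(1/n) ∑_{i<n} ρ_τ(y_i - x_iᵀ β)` of a batch of `n` observations. -/
noncomputable def batchLoss (τ : ℝ) (n : ℕ) (x : ℕ → EuclideanSpace ℝ (Fin p)) (y : ℕ → ℝ)
    (β : EuclideanSpace ℝ (Fin p)) : ℝ :=
  1 / (n : ℝ) * ∑ i ∈ Finset.range n, rho τ (y i - inner ℝ (x i) β)

/-- The weighted Hessian `∑_{i<n} |τ - 1(y_i < x_iᵀ β)| x_i x_iᵀ` of a batch. -/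
noncomputable def batchW (τ : ℝ) (n : ℕ) (x : ℕ → EuclideanSpace ℝ (Fin p)) (y : ℕ → ℝ)
    (β : EuclideanSpace ℝ (Fin p)) : Matrix (Fin p) (Fin p) ℝ :=
  ∑ i ∈ Finset.range n,
    weight τ (y i - inner ℝ (x i) β) • Matrix.vecMulVec (x i).ofLp (x i).ofLp

/-- The vector `∑_{i<n} |τ - 1(y_i < x_iᵀ β)| x_i y_i` of a batch. -/
noncomputable def batchU (τ : ℝ) (n : ℕ) (x : ℕ → EuclideanSpace ℝ (Fin p)) (y : ℕ → ℝ)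
    (β : EuclideanSpace ℝ (Fin p)) : Fin p → ℝ :=
  ∑ i ∈ Finset.range n, (weight τ (y i - inner ℝ (x i) β) * y i) • (x i).ofLp

/-- The cumulative weighted Hessian `∑_{t ≤ b} W_t(β_t)` of the batches `0, …, b`, where `n t` is
the size of batch `t` and `(x t i, y t i)`, `i < n t`, are its observations. -/
noncomputable def cumW (τ : ℝ) (n : ℕ → ℕ) (x : ℕ → ℕ → EuclideanSpace ℝ (Fin p))
    (y : ℕ → ℕ → ℝ) (β : ℕ → EuclideanSpace ℝ (Fin p)) (b : ℕ) : Matrix (Fin p) (Fin p) ℝ :=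
  ∑ t ∈ Finset.range (b + 1), batchW τ (n t) (x t) (y t) (β t)

/-- `β 0, β 1, …` is the sequence of renewable estimates computed by the algorithm from the batches
`0, 1, …` (batches are numbered from `0`): `β 0` minimises the loss of the first batch, and
`β (b+1) = [∑_{t≤b} W_t(β_t) + W_{b+1}(β_b)]⁻¹ [∑_{t≤b} W_t(β_t) β_b + U_{b+1}(β_b)]`. -/
structure IsRenewable (τ : ℝ) (n : ℕ → ℕ) (x : ℕ → ℕ → EuclideanSpace ℝ (Fin p))
    (y : ℕ → ℕ → ℝ) (β : ℕ → EuclideanSpace ℝ (Fin p)) : Prop where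
  init : ∀ γ, batchLoss τ (n 0) (x 0) (y 0) (β 0) ≤ batchLoss τ (n 0) (x 0) (y 0) γ
  step : ∀ b : ℕ, β (b + 1) = WithLp.toLp 2
    ((cumW τ n x y β b + batchW τ (n (b + 1)) (x (b + 1)) (y (b + 1)) (β b))⁻¹ *ᵥ
      (cumW τ n x y β b *ᵥ (β b).ofLp + batchU τ (n (b + 1)) (x (b + 1)) (y (b + 1)) (β b)))

/-- The renewable loss after the arrival of batch `b + 1`,
`(1/N) { (1/2) (γ - β_b)ᵀ [∑_{t≤b} W_t(β_t)] (γ - β_b) + n_{b+1} L_{b+1}(γ) }`,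
where `N = n_0 + … + n_{b+1}` and `L_{b+1}` is the loss of batch `b + 1`. -/
noncomputable def renewableLoss (τ : ℝ) (n : ℕ → ℕ) (x : ℕ → ℕ → EuclideanSpace ℝ (Fin p))
    (y : ℕ → ℕ → ℝ) (β : ℕ → EuclideanSpace ℝ (Fin p)) (b : ℕ)
    (γ : EuclideanSpace ℝ (Fin p)) : ℝ :=
  1 / (∑ t ∈ Finset.range (b + 2), (n t : ℝ)) *
    (1 / 2 * ((γ - β b).ofLp ⬝ᵥ (cumW τ n x y β b *ᵥ (γ - β b).ofLp)) +
      (n (b + 1) : ℝ) * batchLoss τ (n (b + 1)) (x (b + 1)) (y (b + 1)) γ)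

/-- The fully optimised form of the renewable estimates: `β 0` minimises the loss of the first
batch, and `β (b+1)` minimises the renewable loss built from `β 0, …, β b` and batch `b + 1`. -/
structure IsRenewableArgmin (τ : ℝ) (n : ℕ → ℕ) (x : ℕ → ℕ → EuclideanSpace ℝ (Fin p))
    (y : ℕ → ℕ → ℝ) (β : ℕ → EuclideanSpace ℝ (Fin p)) : Prop where
  init : ∀ γ, batchLoss τ (n 0) (x 0) (y 0) (β 0) ≤ batchLoss τ (n 0) (x 0) (y 0) γ
  step : ∀ (b : ℕ) (γ : EuclideanSpace ℝ (Fin p)),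
    renewableLoss τ n x y β b (β (b + 1)) ≤ renewableLoss τ n x y β b γ

/-- The second moment matrix `E[X Xᵀ]` of a random vector. -/
noncomputable def secondMoment {Ω : Type*} [MeasurableSpace Ω] (μ : Measure Ω)
    (X : Ω → EuclideanSpace ℝ (Fin p)) : Matrix (Fin p) (Fin p) ℝ :=
  Matrix.of fun j k => ∫ ω, X ω j * X ω k ∂μ

theorem secondMoment_isHermitian {Ω : Type*} [MeasurableSpace Ω] (μ : Measure Ω)
    (X : Ω → EuclideanSpace ℝ (Fin p)) : (secondMoment μ X).IsHermitian := by
  ext j k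
  simp [secondMoment, mul_comm]

/-- The conditional law of the error `Y - Xᵀ β₀` given `X`. -/
noncomputable def errorLaw {Ω : Type*} [MeasurableSpace Ω] (μ : Measure Ω) [IsFiniteMeasure μ]
    (X : Ω → EuclideanSpace ℝ (Fin p)) (Y : Ω → ℝ) (β₀ : EuclideanSpace ℝ (Fin p)) :
    Kernel (EuclideanSpace ℝ (Fin p)) ℝ :=
  condDistrib (fun ω => Y ω - inner ℝ (X ω) β₀) X μ

end ReER

namespace ReER

/-! ### Pointwise estimates for the asymmetric weight, loss and score -/

section Weight

variable {τ : ℝ}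

/-! The danger is that each update adds a linearization error and that these errors accumulate over
an unbounded number of batches. They do not, because the weight of an observation depends only on
the sign of its residual. For coefficients within `r` of `β₀` and regressors bounded by `c`, that
sign can differ from the sign of the true error `e` only if `|e| ≤ c * r`. Each batch can therefore
be charged for its own small errors only, and over all batches these are a fraction `q` of the data.

The argument is deterministic on a `GoodSample`. The invariant `Tracks` says that the current
estimate is within `r` of `β₀`, and that the accumulated Hessian applied to its deviation equals the
accumulated score at `β₀` up to `2 * c ^ 2 * r` per small error. Testing this kind of relation on
the deviation `d` itself, coercivity of the design gives `a κ N ‖d‖² ≤ (η + 2c²rq) N ‖d‖` with `a =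
min τ (1 - τ)`. Hence `‖d‖ ≤ r` once `η + 2c²rq ≤ aκr` (`norm_le_of_form_le`), and the induction
over batches closes with the same `r`. The two `tracks_succ` lemmas do this for the two forms of the
update.

The sample is good with probability tending to one. The batches are laid end to end, so every
accumulated sum is a partial sum of length at least the first batch size, and the strong law
controls all long partial sums at once (`tendsto_measure_exists_deviation`). The expectile condition
centres the score, and since the error has no atom at zero, `q` can be made small by shrinking `r`.
-/

theorem weight_of_neg {τ u : ℝ} (hτ : τ < 1) (hu : u < 0) : weight τ u = 1 - τ := by
  rw [weight, if_pos hu, abs_of_neg (by linarith)]; ring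

theorem weight_of_nonneg {τ u : ℝ} (hτ : 0 < τ) (hu : 0 ≤ u) : weight τ u = τ := by
  rw [weight, if_neg hu.not_gt, sub_zero, abs_of_pos hτ]

theorem min_le_weight (h₀ : 0 < τ) (h₁ : τ < 1) (u : ℝ) : min τ (1 - τ) ≤ weight τ u := by
  rcases lt_or_ge u 0 with hu | hu
  · rw [weight_of_neg h₁ hu]; exact min_le_right _ _
  · rw [weight_of_nonneg h₀ hu]; exact min_le_left _ _

theorem weight_le_one (h₀ : 0 < τ) (h₁ : τ < 1) (u : ℝ) : weight τ u ≤ 1 := by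
  rcases lt_or_ge u 0 with hu | hu
  · rw [weight_of_neg h₁ hu]; linarith
  · rw [weight_of_nonneg h₀ hu]; linarith

theorem weight_nonneg (u : ℝ) : 0 ≤ weight τ u := abs_nonneg _

theorem measurable_weight (τ : ℝ) : Measurable (weight τ) := by
  unfold weight
  have : Measurable fun u : ℝ => if u < 0 then (1 : ℝ) else 0 :=
    Measurable.ite measurableSet_Iio measurable_const measurable_const
  exact (measurable_const.sub this).abs

theorem abs_weight_sub_weight_le_one (h₀ : 0 < τ) (h₁ : τ < 1) (u v : ℝ) :
    |weight τ u - weight τ v| ≤ 1 := by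
  have := weight_le_one h₀ h₁ u
  have := weight_le_one h₀ h₁ v
  have := weight_nonneg (τ := τ) u
  have := weight_nonneg (τ := τ) v
  rw [abs_le]; constructor <;> linarith

/-- The weights at two perturbations of `e` of size at most `s` agree unless `|e| ≤ s`. -/
theorem abs_weight_sub_weight_le (h₀ : 0 < τ) (h₁ : τ < 1) {e h h' s : ℝ} (hh : |h| ≤ s)
    (hh' : |h'| ≤ s) :
    |weight τ (e - h) - weight τ (e - h')| ≤ if |e| ≤ s then 1 else 0 := by
  split_ifs with he
  · exact abs_weight_sub_weight_le_one h₀ h₁ _ _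
  · rw [abs_le] at hh hh'
    rw [not_le, lt_abs] at he
    rcases he with he | he
    · rw [weight_of_nonneg h₀ (by linarith), weight_of_nonneg h₀ (by linarith)]; simp
    · rw [weight_of_neg h₁ (by linarith), weight_of_neg h₁ (by linarith)]; simp

/-- The weight changes only when `|e| ≤ s`, and then the factor `e` is itself at most `s`. This
extra factor makes the error in the score of order `r` per small error. -/
theorem abs_weight_sub_weight_mul_le (h₀ : 0 < τ) (h₁ : τ < 1) {e h s g : ℝ} (hh : |h| ≤ s) :
    |(weight τ (e - h) - weight τ e) * e * g| ≤ (if |e| ≤ s then 1 else 0) * (s * |g|) := by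
  have key := abs_weight_sub_weight_le h₀ h₁ (e := e) hh
    (h' := 0) (by simpa using (abs_nonneg h).trans hh)
  rw [sub_zero] at key
  rw [abs_mul, abs_mul, mul_assoc]
  split_ifs at key ⊢ with he
  · exact mul_le_mul key (by gcongr) (by positivity) zero_le_one
  · rw [le_antisymm key (abs_nonneg _)]; simp

/-- The loss `ρ_τ` lies below the parabola of curvature `1` tangent to it. -/
theorem rho_add_le (h₀ : 0 < τ) (h₁ : τ < 1) (u h : ℝ) :
    rho τ (u + h) ≤ rho τ u + weight τ u * u * h + h ^ 2 / 2 := by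
  unfold rho
  rcases lt_or_ge u 0 with hu | hu <;> rcases lt_or_ge (u + h) 0 with hv | hv
  · rw [weight_of_neg h₁ hu, weight_of_neg h₁ hv]; nlinarith [mul_nonneg h₀.le (sq_nonneg h)]
  · rw [weight_of_neg h₁ hu, weight_of_nonneg h₀ hv]
    nlinarith [mul_nonneg h₀.le (sq_nonneg h), mul_nonneg h₀.le (sq_nonneg u),
      mul_nonneg (sub_pos.2 h₁).le (mul_nonneg hv (neg_nonneg.2 hu.le)),
      mul_nonneg (sub_pos.2 h₁).le (sq_nonneg (u + h)), mul_nonneg h₀.le (sq_nonneg (u + h)),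
      mul_nonneg h₀.le (mul_nonneg hv (neg_nonneg.2 hu.le))]
  · rw [weight_of_nonneg h₀ hu, weight_of_neg h₁ hv]
    nlinarith [mul_nonneg h₀.le (sq_nonneg h), mul_nonneg h₀.le (sq_nonneg u),
      mul_nonneg (sub_pos.2 h₁).le (mul_nonneg hu (neg_nonneg.2 hv.le)),
      mul_nonneg (sub_pos.2 h₁).le (sq_nonneg u), mul_nonneg h₀.le (sq_nonneg (u + h)),
      mul_nonneg h₀.le (mul_nonneg hu (neg_nonneg.2 hv.le))]
  · rw [weight_of_nonneg h₀ hu, weight_of_nonneg h₀ hv]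
    nlinarith [mul_nonneg (sub_pos.2 h₁).le (sq_nonneg h)]

/-- Strong monotonicity of the score `u ↦ weight τ u * u`. -/
theorem min_mul_sq_le (h₀ : 0 < τ) (h₁ : τ < 1) (e h : ℝ) :
    min τ (1 - τ) * h ^ 2 ≤ (weight τ e * e - weight τ (e - h) * (e - h)) * h := by
  have ha : min τ (1 - τ) ≤ τ := min_le_left _ _
  have hb : min τ (1 - τ) ≤ 1 - τ := min_le_right _ _
  set a := min τ (1 - τ)
  rcases lt_or_ge e 0 with hu | hu <;> rcases lt_or_ge (e - h) 0 with hv | hv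
  · rw [weight_of_neg h₁ hu, weight_of_neg h₁ hv]
    nlinarith [mul_nonneg (sub_nonneg.2 hb) (sq_nonneg h)]
  · rw [weight_of_neg h₁ hu, weight_of_nonneg h₀ hv]
    have hh : 0 ≤ -h := by linarith
    nlinarith [mul_nonneg (mul_nonneg (sub_nonneg.2 hb) (neg_nonneg.2 hu.le)) hh,
      mul_nonneg (mul_nonneg (sub_nonneg.2 ha) hv) hh]
  · rw [weight_of_nonneg h₀ hu, weight_of_neg h₁ hv]
    have hh : 0 ≤ h := by linarith
    nlinarith [mul_nonneg (mul_nonneg (sub_nonneg.2 ha) hu) hh,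
      mul_nonneg (mul_nonneg (sub_nonneg.2 hb) (neg_nonneg.2 hv.le)) hh]
  · rw [weight_of_nonneg h₀ hu, weight_of_nonneg h₀ hv]
    nlinarith [mul_nonneg (sub_nonneg.2 ha) (sq_nonneg h)]

/-- Together with the tangent parabola of `rho_add_le`, this yields first-order conditions without
differentiating the loss. -/
theorem eq_zero_of_forall_nonneg {G C : ℝ} (h : ∀ s : ℝ, 0 ≤ s * G + s ^ 2 * C) : G = 0 := by
  have hC : 0 < |C| + 1 := by positivity
  -- The minimizer of the parabola after enlarging `C` to `|C| + 1`, which is positive whatever the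
  -- sign of `C`.
  have h1 := h (-G / (2 * (|C| + 1)))
  have h2 : (-G / (2 * (|C| + 1))) * G + (-G / (2 * (|C| + 1))) ^ 2 * C
      ≤ (-G / (2 * (|C| + 1))) * G + (-G / (2 * (|C| + 1))) ^ 2 * (|C| + 1) := by
    gcongr; linarith [le_abs_self C]
  have h3 : (-G / (2 * (|C| + 1))) * G + (-G / (2 * (|C| + 1))) ^ 2 * (|C| + 1)
      = - (G ^ 2 / (4 * (|C| + 1))) := by field_simp; ring
  have h4 : G ^ 2 / (4 * (|C| + 1)) ≤ 0 := by linarith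
  have h5 : G ^ 2 ≤ 0 := by
    by_contra! hG
    exact absurd h4 (not_le.2 (by positivity))
  exact pow_eq_zero_iff two_ne_zero |>.1 (le_antisymm h5 (sq_nonneg _))

end Weight

/-! ### Quadratic forms of the Hessians and the first-order condition -/

section Forms

variable {p : ℕ}

local notation "𝔼" => EuclideanSpace ℝ (Fin p)

theorem ofLp_dotProduct_ofLp (u v : 𝔼) : u.ofLp ⬝ᵥ v.ofLp = inner ℝ u v := by
  rw [EuclideanSpace.inner_eq_star_dotProduct, star_trivial, dotProduct_comm]

theorem dotProduct_batchW_mulVec (τ : ℝ) (n : ℕ) (x : ℕ → 𝔼) (y : ℕ → ℝ) (β u v : 𝔼) :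
    v.ofLp ⬝ᵥ (batchW τ n x y β *ᵥ u.ofLp) = ∑ i ∈ Finset.range n,
      weight τ (y i - inner ℝ (x i) β) * inner ℝ (x i) u * inner ℝ (x i) v := by
  rw [batchW, Matrix.sum_mulVec, dotProduct_sum]
  refine Finset.sum_congr rfl fun i _ => ?_
  rw [Matrix.smul_mulVec, Matrix.vecMulVec_mulVec, dotProduct_smul, dotProduct_smul,
    ofLp_dotProduct_ofLp, ofLp_dotProduct_ofLp, real_inner_comm (x i) v]
  simp only [smul_eq_mul, MulOpposite.smul_eq_mul_unop, MulOpposite.unop_op]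
  ring

theorem dotProduct_batchU (τ : ℝ) (n : ℕ) (x : ℕ → 𝔼) (y : ℕ → ℝ) (β v : 𝔼) :
    v.ofLp ⬝ᵥ batchU τ n x y β = ∑ i ∈ Finset.range n,
      weight τ (y i - inner ℝ (x i) β) * y i * inner ℝ (x i) v := by
  rw [batchU, dotProduct_sum]
  refine Finset.sum_congr rfl fun i _ => ?_
  rw [dotProduct_smul, ofLp_dotProduct_ofLp, real_inner_comm (x i) v, smul_eq_mul]

/-- The bilinear form of the cumulative weighted Hessian. -/
noncomputable def cumForm (τ : ℝ) (n : ℕ → ℕ) (x : ℕ → ℕ → 𝔼) (y : ℕ → ℕ → ℝ) (β : ℕ → 𝔼)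
    (b : ℕ) (u v : 𝔼) : ℝ :=
  ∑ t ∈ Finset.range (b + 1), ∑ i ∈ Finset.range (n t),
    weight τ (y t i - inner ℝ (x t i) (β t)) * inner ℝ (x t i) u * inner ℝ (x t i) v

theorem dotProduct_cumW_mulVec (τ : ℝ) (n : ℕ → ℕ) (x : ℕ → ℕ → 𝔼) (y : ℕ → ℕ → ℝ) (β : ℕ → 𝔼)
    (b : ℕ) (u v : 𝔼) :
    v.ofLp ⬝ᵥ (cumW τ n x y β b *ᵥ u.ofLp) = cumForm τ n x y β b u v := by
  rw [cumW, Matrix.sum_mulVec, dotProduct_sum]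
  exact Finset.sum_congr rfl fun t _ => dotProduct_batchW_mulVec ..

theorem cumForm_sub_left (τ : ℝ) (n : ℕ → ℕ) (x : ℕ → ℕ → 𝔼) (y : ℕ → ℕ → ℝ) (β : ℕ → 𝔼)
    (b : ℕ) (u u' v : 𝔼) :
    cumForm τ n x y β b (u - u') v = cumForm τ n x y β b u v - cumForm τ n x y β b u' v := by
  simp only [cumForm, ← Finset.sum_sub_distrib, inner_sub_right]
  refine Finset.sum_congr rfl fun t _ => Finset.sum_congr rfl fun i _ => ?_
  ring

theorem cumForm_add_smul_self (τ : ℝ) (n : ℕ → ℕ) (x : ℕ → ℕ → 𝔼) (y : ℕ → ℕ → ℝ) (β : ℕ → 𝔼)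
    (b : ℕ) (u v : 𝔼) (s : ℝ) :
    cumForm τ n x y β b (u + s • v) (u + s • v) = cumForm τ n x y β b u u +
      2 * s * cumForm τ n x y β b u v + s ^ 2 * cumForm τ n x y β b v v := by
  simp only [cumForm, Finset.mul_sum, ← Finset.sum_add_distrib, inner_add_right, inner_smul_right]
  refine Finset.sum_congr rfl fun t _ => Finset.sum_congr rfl fun i _ => ?_
  ring

/-- First-order optimality for a quadratic form plus a batch loss. -/
theorem sum_score_eq_of_isMin {τ : ℝ} (h₀ : 0 < τ) (h₁ : τ < 1) (n : ℕ) (x : ℕ → 𝔼) (y : ℕ → ℝ)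
    (Q : 𝔼 → ℝ) (L C : ℝ) (β v : 𝔼)
    (hQ : ∀ s : ℝ, Q (β + s • v) = Q β + s * L + s ^ 2 * C)
    (hmin : ∀ γ, Q β + ∑ i ∈ Finset.range n, rho τ (y i - inner ℝ (x i) β)
      ≤ Q γ + ∑ i ∈ Finset.range n, rho τ (y i - inner ℝ (x i) γ)) :
    L = ∑ i ∈ Finset.range n,
      weight τ (y i - inner ℝ (x i) β) * (y i - inner ℝ (x i) β) * inner ℝ (x i) v := by
  rw [← sub_eq_zero]
  refine eq_zero_of_forall_nonneg
    (C := C + ∑ i ∈ Finset.range n, inner ℝ (x i) v ^ 2 / 2) fun s => ?_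
  have h1 := hmin (β + s • v)
  have h2 : ∑ i ∈ Finset.range n, rho τ (y i - inner ℝ (x i) (β + s • v)) ≤
      ∑ i ∈ Finset.range n, (rho τ (y i - inner ℝ (x i) β)
        - s * (weight τ (y i - inner ℝ (x i) β) * (y i - inner ℝ (x i) β) * inner ℝ (x i) v)
        + s ^ 2 * (inner ℝ (x i) v ^ 2 / 2)) := by
    refine Finset.sum_le_sum fun i _ => ?_
    have := rho_add_le h₀ h₁ (y i - inner ℝ (x i) β) (-(s * inner ℝ (x i) v))
    rw [inner_add_right, inner_smul_right]
    calc _ = rho τ (y i - inner ℝ (x i) β + -(s * inner ℝ (x i) v)) := by congr 1; ring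
      _ ≤ _ := this
      _ = _ := by ring
  rw [Finset.sum_add_distrib, Finset.sum_sub_distrib, ← Finset.mul_sum, ← Finset.mul_sum] at h2
  rw [hQ s] at h1
  nlinarith

end Forms

/-! ### Deterministic induction over the batches on a good sample -/

section Good

variable {p : ℕ}

local notation "𝔼" => EuclideanSpace ℝ (Fin p)

/-- The sum of `g t i` over the observations of the batches `0, …, b`. -/
noncomputable def cumSum (n : ℕ → ℕ) (g : ℕ → ℕ → ℝ) (b : ℕ) : ℝ :=
  ∑ t ∈ Finset.range (b + 1), ∑ i ∈ Finset.range (n t), g t i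

theorem cumSum_succ (n : ℕ → ℕ) (g : ℕ → ℕ → ℝ) (b : ℕ) :
    cumSum n g (b + 1) = cumSum n g b + ∑ i ∈ Finset.range (n (b + 1)), g (b + 1) i := by
  rw [cumSum, Finset.sum_range_succ, cumSum]

/-- A sample on which the second moments of the design, the number of errors of size at most
`c * r` and the score at `β₀` are under control for all batches. -/
structure GoodSample (τ : ℝ) (n : ℕ → ℕ) (x : ℕ → ℕ → 𝔼) (y : ℕ → ℕ → ℝ) (β₀ : 𝔼)
    (c r κ q η : ℝ) : Prop where
  norm_le : ∀ t i, ‖x t i‖ ≤ c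
  design : ∀ b v, κ * cumSum n (fun _ _ => 1) b * ‖v‖ ^ 2 ≤
    cumSum n (fun t i => inner ℝ (x t i) v ^ 2) b
  near : ∀ b, cumSum n (fun t i => if |y t i - inner ℝ (x t i) β₀| ≤ c * r then 1 else 0) b ≤
    q * cumSum n (fun _ _ => 1) b
  score : ∀ b v, |cumSum n (fun t i => weight τ (y t i - inner ℝ (x t i) β₀) *
      (y t i - inner ℝ (x t i) β₀) * inner ℝ (x t i) v) b| ≤ η * cumSum n (fun _ _ => 1) b * ‖v‖

namespace GoodSample

variable {τ : ℝ} {n : ℕ → ℕ} {x : ℕ → ℕ → EuclideanSpace ℝ (Fin p)} {y : ℕ → ℕ → ℝ}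
  {β₀ : EuclideanSpace ℝ (Fin p)} {c r κ q η : ℝ}

theorem sub_inner_eq (u β β₀ : 𝔼) (z : ℝ) :
    z - inner ℝ u β = z - inner ℝ u β₀ - inner ℝ u (β - β₀) := by
  rw [inner_sub_right]; ring

theorem abs_inner_le (hG : GoodSample τ n x y β₀ c r κ q η) (t i : ℕ) {v : 𝔼} {s : ℝ}
    (hv : ‖v‖ ≤ s) : |inner ℝ (x t i) v| ≤ c * s :=
  (abs_real_inner_le_norm _ _).trans
    (mul_le_mul (hG.norm_le t i) hv (norm_nonneg _) ((norm_nonneg _).trans (hG.norm_le t i)))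

theorem c_nonneg (hG : GoodSample τ n x y β₀ c r κ q η) : 0 ≤ c :=
  (norm_nonneg _).trans (hG.norm_le 0 0)

theorem cumSum_one_pos (hn : ∀ t, 0 < n t) (b : ℕ) : 0 < cumSum n (fun _ _ => 1) b := by
  refine Finset.sum_pos (fun t _ => ?_) ⟨0, by simp⟩
  simpa using hn t

/-- An element `d` is small if its quadratic form is dominated by a quantity close to the score. -/
theorem norm_le_of_form_le (hG : GoodSample τ n x y β₀ c r κ q η) (hn : ∀ t, 0 < n t)
    {a : ℝ} (ha : 0 < a) (hκ : 0 < κ) (hr : 0 ≤ r) (hsmall : η + 2 * c ^ 2 * r * q ≤ a * κ * r)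
    (b : ℕ) (d : 𝔼) (T : ℝ)
    (hT : a * cumSum n (fun t i => inner ℝ (x t i) d ^ 2) b ≤ T)
    (hTs : |T - cumSum n (fun t i => weight τ (y t i - inner ℝ (x t i) β₀) *
      (y t i - inner ℝ (x t i) β₀) * inner ℝ (x t i) d) b| ≤ 2 * c ^ 2 * r * ‖d‖ *
      cumSum n (fun t i => if |y t i - inner ℝ (x t i) β₀| ≤ c * r then 1 else 0) b) :
    ‖d‖ ≤ r := by
  by_contra! hd
  have hN := cumSum_one_pos hn b
  have h1 := hG.design b d
  have h2 := hG.near b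
  have h3 := hG.score b d
  rw [abs_le] at hTs h3
  set N := cumSum n (fun _ _ => 1) b
  set K := cumSum n (fun t i => if |y t i - inner ℝ (x t i) β₀| ≤ c * r then 1 else 0) b
  have hdpos : 0 < ‖d‖ := hr.trans_lt hd
  have h4 : 2 * c ^ 2 * r * ‖d‖ * K ≤ 2 * c ^ 2 * r * ‖d‖ * (q * N) := by gcongr
  have h5 : a * (κ * N * ‖d‖ ^ 2) ≤ T := le_trans (by gcongr) hT
  -- The left side is quadratic in `‖d‖` and the right side linear, so `‖d‖ > r` contradicts the
  -- smallness condition.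
  have h6 : a * (κ * N * ‖d‖ ^ 2) ≤ (η + 2 * c ^ 2 * r * q) * (N * ‖d‖) := by linarith
  have h7 : (η + 2 * c ^ 2 * r * q) * (N * ‖d‖) ≤ (a * κ * r) * (N * ‖d‖) := by gcongr
  have h8 : (a * κ * r) * (N * ‖d‖) < (a * κ * ‖d‖) * (N * ‖d‖) := by gcongr
  linarith

/-- The estimates of the batches up to `b` are close to `β₀`, and the estimate of batch `b` solves
the score equation of all the batches up to an error of second order. -/
def Tracks (τ : ℝ) (n : ℕ → ℕ) (x : ℕ → ℕ → 𝔼) (y : ℕ → ℕ → ℝ) (β₀ : 𝔼) (c r : ℝ) (β : ℕ → 𝔼)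
    (b : ℕ) : Prop :=
  ‖β b - β₀‖ ≤ r ∧ ∀ v, |cumForm τ n x y β b (β b - β₀) v -
    cumSum n (fun t i => weight τ (y t i - inner ℝ (x t i) β₀) *
      (y t i - inner ℝ (x t i) β₀) * inner ℝ (x t i) v) b| ≤ 2 * c ^ 2 * r * ‖v‖ *
      cumSum n (fun t i => if |y t i - inner ℝ (x t i) β₀| ≤ c * r then 1 else 0) b

/-- Replacing the weights at `β₀` by those at a nearby point changes a batch score little. -/
theorem abs_sum_weight_sub_mul_le (h₀ : 0 < τ) (h₁ : τ < 1)
    (hG : GoodSample τ n x y β₀ c r κ q η) (hr : 0 ≤ r) (t : ℕ) {β : 𝔼} (hβ : ‖β - β₀‖ ≤ r)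
    (v : 𝔼) :
    |∑ i ∈ Finset.range (n t), weight τ (y t i - inner ℝ (x t i) β) *
        (y t i - inner ℝ (x t i) β₀) * inner ℝ (x t i) v -
      ∑ i ∈ Finset.range (n t), weight τ (y t i - inner ℝ (x t i) β₀) *
        (y t i - inner ℝ (x t i) β₀) * inner ℝ (x t i) v| ≤ c ^ 2 * r * ‖v‖ *
      ∑ i ∈ Finset.range (n t), if |y t i - inner ℝ (x t i) β₀| ≤ c * r then 1 else 0 := by
  rw [← Finset.sum_sub_distrib, Finset.mul_sum]
  refine (Finset.abs_sum_le_sum_abs _ _).trans (Finset.sum_le_sum fun i _ => ?_)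
  have h := abs_weight_sub_weight_mul_le h₀ h₁ (e := y t i - inner ℝ (x t i) β₀)
    (g := inner ℝ (x t i) v) (hG.abs_inner_le t i hβ)
  rw [← sub_inner_eq] at h
  rw [← sub_mul, ← sub_mul]
  refine h.trans ?_
  have hv : |inner ℝ (x t i) v| ≤ c * ‖v‖ := hG.abs_inner_le t i le_rfl
  have hc := hG.c_nonneg
  rw [mul_comm]
  refine mul_le_mul_of_nonneg_right ?_ (by split_ifs <;> norm_num)
  calc c * r * |inner ℝ (x t i) v| ≤ c * r * (c * ‖v‖) := by gcongr
    _ = _ := by ring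

/-- The batch Hessians at two points near `β₀` are close to each other. -/
theorem abs_sum_weight_sub_weight_le (h₀ : 0 < τ) (h₁ : τ < 1)
    (hG : GoodSample τ n x y β₀ c r κ q η) (hr : 0 ≤ r) (t : ℕ) {β β' d : 𝔼} (hβ : ‖β - β₀‖ ≤ r)
    (hβ' : ‖β' - β₀‖ ≤ r) (hd : ‖d‖ ≤ r) (v : 𝔼) :
    |∑ i ∈ Finset.range (n t), weight τ (y t i - inner ℝ (x t i) β) *
        inner ℝ (x t i) d * inner ℝ (x t i) v -
      ∑ i ∈ Finset.range (n t), weight τ (y t i - inner ℝ (x t i) β') *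
        inner ℝ (x t i) d * inner ℝ (x t i) v| ≤ c ^ 2 * r * ‖v‖ *
      ∑ i ∈ Finset.range (n t), if |y t i - inner ℝ (x t i) β₀| ≤ c * r then 1 else 0 := by
  rw [← Finset.sum_sub_distrib, Finset.mul_sum]
  refine (Finset.abs_sum_le_sum_abs _ _).trans (Finset.sum_le_sum fun i _ => ?_)
  have h := abs_weight_sub_weight_le h₀ h₁ (e := y t i - inner ℝ (x t i) β₀)
    (hG.abs_inner_le t i hβ) (hG.abs_inner_le t i hβ')
  rw [← sub_inner_eq, ← sub_inner_eq] at h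
  rw [← sub_mul, ← sub_mul, abs_mul, abs_mul, mul_assoc, mul_comm]
  have hv : |inner ℝ (x t i) v| ≤ c * ‖v‖ := hG.abs_inner_le t i le_rfl
  have hd' : |inner ℝ (x t i) d| ≤ c * r := hG.abs_inner_le t i hd
  have hc := hG.c_nonneg
  refine mul_le_mul ?_ h (abs_nonneg _) (by positivity)
  calc |inner ℝ (x t i) d| * |inner ℝ (x t i) v| ≤ c * r * (c * ‖v‖) := by gcongr
    _ = _ := by ring

theorem near_batch_nonneg (t : ℕ) : 0 ≤ ∑ i ∈ Finset.range (n t),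
    if |y t i - inner ℝ (x t i) β₀| ≤ c * r then (1 : ℝ) else 0 :=
  Finset.sum_nonneg fun _ _ => by split_ifs <;> norm_num

/-- With no earlier batch the score at the minimizer vanishes. Strong monotonicity of the score then
bounds the deviation with no a priori localization; only afterwards are the weights at the estimate
compared with those at `β₀`. -/
theorem tracks_zero (h₀ : 0 < τ) (h₁ : τ < 1) (hG : GoodSample τ n x y β₀ c r κ q η)
    (hn : ∀ t, 0 < n t) (hκ : 0 < κ) (hr : 0 ≤ r)
    (hsmall : η + 2 * c ^ 2 * r * q ≤ min τ (1 - τ) * κ * r) {β : ℕ → 𝔼}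
    (hmin : ∀ γ, batchLoss τ (n 0) (x 0) (y 0) (β 0) ≤ batchLoss τ (n 0) (x 0) (y 0) γ) :
    Tracks τ n x y β₀ c r β 0 := by
  have hn0 : (0 : ℝ) < n 0 := by exact_mod_cast hn 0
  have hc := hG.c_nonneg
  have hfoc : ∀ v, (0 : ℝ) = ∑ i ∈ Finset.range (n 0),
      weight τ (y 0 i - inner ℝ (x 0 i) (β 0)) * (y 0 i - inner ℝ (x 0 i) (β 0)) *
        inner ℝ (x 0 i) v := fun v =>
    sum_score_eq_of_isMin h₀ h₁ (n 0) (x 0) (y 0) (fun _ => 0) 0 0 (β 0) v (by simp) fun γ => by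
      have := hmin γ
      unfold batchLoss at this
      simpa using le_of_mul_le_mul_left this (by positivity)
  have hnear := near_batch_nonneg (n := n) (x := x) (y := y) (β₀ := β₀) (c := c) (r := r) 0
  have hclose : ‖β 0 - β₀‖ ≤ r := by
    refine hG.norm_le_of_form_le hn (lt_min h₀ (sub_pos.2 h₁)) hκ hr hsmall 0 (β 0 - β₀)
      (cumSum n (fun t i => weight τ (y t i - inner ℝ (x t i) β₀) *
      (y t i - inner ℝ (x t i) β₀) * inner ℝ (x t i) (β 0 - β₀)) 0) ?_ ?_
    · have h := hfoc (β 0 - β₀)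
      simp only [cumSum, zero_add, Finset.sum_range_one]
      rw [← sub_zero (∑ i ∈ Finset.range (n 0), weight τ (y 0 i - inner ℝ (x 0 i) β₀) * _ * _), h,
        ← Finset.sum_sub_distrib, Finset.mul_sum]
      refine Finset.sum_le_sum fun i _ => ?_
      rw [← sub_mul, sub_inner_eq (x 0 i) (β 0) β₀]
      exact min_mul_sq_le h₀ h₁ _ _
    · rw [sub_self, abs_zero]
      simp only [cumSum, zero_add, Finset.sum_range_one]
      positivity
  refine ⟨hclose, fun v => ?_⟩
  have h2 := hG.abs_sum_weight_sub_mul_le h₀ h₁ hr 0 hclose v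
  have h3 : cumForm τ n x y β 0 (β 0 - β₀) v = ∑ i ∈ Finset.range (n 0),
      weight τ (y 0 i - inner ℝ (x 0 i) (β 0)) *
        (y 0 i - inner ℝ (x 0 i) β₀) * inner ℝ (x 0 i) v := by
    -- Adding the vanishing score turns each fitted difference into the true error: residual plus
    -- `inner (x i) (β 0 - β₀)` is the error at `β₀`.
    rw [← zero_add (cumForm ..), hfoc v, cumForm, zero_add, Finset.sum_range_one,
      ← Finset.sum_add_distrib]
    refine Finset.sum_congr rfl fun i _ => ?_
    rw [inner_sub_right]; ring
  rw [h3]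
  simp only [cumSum, zero_add, Finset.sum_range_one]
  refine h2.trans ?_
  nlinarith [show 0 ≤ c ^ 2 * r * ‖v‖ by positivity]

theorem min_mul_cumSum_sq_le (h₀ : 0 < τ) (h₁ : τ < 1) (β : ℕ → 𝔼) (b : ℕ) (d : 𝔼) :
    min τ (1 - τ) * cumSum n (fun t i => inner ℝ (x t i) d ^ 2) b ≤
      cumForm τ n x y β b d d := by
  simp only [cumSum, cumForm, Finset.mul_sum]
  refine Finset.sum_le_sum fun t _ => Finset.sum_le_sum fun i _ => ?_
  rw [mul_assoc, ← sq]
  exact mul_le_mul_of_nonneg_right (min_le_weight h₀ h₁ _) (sq_nonneg _)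

/-- The first-order condition balances the old form at `β (b + 1) - β b` against the new batch
score. Adding the invariant at `b` replaces the centre `β b` by `β₀`. -/
theorem tracks_succ_of_isRenewableArgmin (h₀ : 0 < τ) (h₁ : τ < 1)
    (hG : GoodSample τ n x y β₀ c r κ q η) (hn : ∀ t, 0 < n t) (hκ : 0 < κ) (hr : 0 ≤ r)
    (hsmall : η + 2 * c ^ 2 * r * q ≤ min τ (1 - τ) * κ * r) {β : ℕ → 𝔼} {b : ℕ}
    (hb : Tracks τ n x y β₀ c r β b)
    (hmin : ∀ γ, renewableLoss τ n x y β b (β (b + 1)) ≤ renewableLoss τ n x y β b γ) :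
    Tracks τ n x y β₀ c r β (b + 1) := by
  have hc := hG.c_nonneg
  have hnb : (n (b + 1) : ℝ) ≠ 0 := by exact_mod_cast (hn (b + 1)).ne'
  have hN : (0 : ℝ) < ∑ t ∈ Finset.range (b + 2), (n t : ℝ) :=
    Finset.sum_pos (fun t _ => by exact_mod_cast hn t) ⟨0, by simp⟩
  have hfoc : ∀ v, cumForm τ n x y β b (β (b + 1) - β b) v = ∑ i ∈ Finset.range (n (b + 1)),
      weight τ (y (b + 1) i - inner ℝ (x (b + 1) i) (β (b + 1))) *
        (y (b + 1) i - inner ℝ (x (b + 1) i) (β (b + 1))) * inner ℝ (x (b + 1) i) v := fun v =>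
    sum_score_eq_of_isMin h₀ h₁ (n (b + 1)) (x (b + 1)) (y (b + 1))
      (fun γ => 1 / 2 * cumForm τ n x y β b (γ - β b) (γ - β b)) _
      (1 / 2 * cumForm τ n x y β b v v) (β (b + 1)) v
      (fun s => by
        rw [add_sub_right_comm, cumForm_add_smul_self]; ring)
      fun γ => by
        have := hmin γ
        unfold renewableLoss batchLoss at this
        simpa only [dotProduct_cumW_mulVec, one_div, mul_inv_cancel_left₀ hnb] using
          le_of_mul_le_mul_left this (by positivity)
  obtain ⟨hclose, herr⟩ := hb
  have hnear := near_batch_nonneg (n := n) (x := x) (y := y) (β₀ := β₀) (c := c) (r := r) (b + 1)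
  have hsplit : ∀ v, cumForm τ n x y β b (β (b + 1) - β₀) v =
      cumForm τ n x y β b (β b - β₀) v + cumForm τ n x y β b (β (b + 1) - β b) v := by
    intro v
    rw [cumForm_sub_left, cumForm_sub_left, cumForm_sub_left]; ring
  have hclose' : ‖β (b + 1) - β₀‖ ≤ r := by
    set d := β (b + 1) - β₀ with hd
    -- The test quantity takes the new batch score at `β₀`. It thus differs from the total score by
    -- the inherited error alone, while strong monotonicity bounds it below, so nothing need be
    -- known beforehand about `β (b + 1)`.
    refine hG.norm_le_of_form_le hn (lt_min h₀ (sub_pos.2 h₁)) hκ hr hsmall (b + 1) d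
      (cumForm τ n x y β b (β b - β₀) d + ∑ i ∈ Finset.range (n (b + 1)),
        weight τ (y (b + 1) i - inner ℝ (x (b + 1) i) β₀) *
          (y (b + 1) i - inner ℝ (x (b + 1) i) β₀) * inner ℝ (x (b + 1) i) d) ?_ ?_
    · have h1 := hsplit d
      rw [hfoc d] at h1
      rw [eq_sub_of_add_eq h1.symm, cumSum_succ, mul_add, sub_add, sub_eq_add_neg]
      refine add_le_add (min_mul_cumSum_sq_le h₀ h₁ β b d) ?_
      rw [neg_sub, ← Finset.sum_sub_distrib, Finset.mul_sum]
      refine Finset.sum_le_sum fun i _ => ?_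
      rw [← sub_mul, sub_inner_eq (x (b + 1) i) (β (b + 1)) β₀]
      exact min_mul_sq_le h₀ h₁ _ _
    · rw [cumSum_succ, cumSum_succ, add_sub_add_right_eq_sub]
      refine (herr d).trans ?_
      gcongr
      linarith
  refine ⟨hclose', fun v => ?_⟩
  have h2 := hG.abs_sum_weight_sub_mul_le h₀ h₁ hr (b + 1) hclose' v
  have h3 : cumForm τ n x y β (b + 1) (β (b + 1) - β₀) v = cumForm τ n x y β b (β b - β₀) v +
      ∑ i ∈ Finset.range (n (b + 1)), weight τ (y (b + 1) i - inner ℝ (x (b + 1) i) (β (b + 1))) *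
        (y (b + 1) i - inner ℝ (x (b + 1) i) β₀) * inner ℝ (x (b + 1) i) v := by
    rw [cumForm, Finset.sum_range_succ, ← cumForm, hsplit, hfoc, add_assoc,
      ← Finset.sum_add_distrib]
    congr 1
    refine Finset.sum_congr rfl fun i _ => ?_
    rw [inner_sub_right]; ring
  rw [h3, cumSum_succ, cumSum_succ, add_sub_add_comm]
  refine (abs_add_le _ _).trans ((add_le_add (herr v) h2).trans ?_)
  rw [mul_add]
  nlinarith [show 0 ≤ c ^ 2 * r * ‖v‖ by positivity]

/-- The new batch is charged twice, which explains the factor `2` in the invariant: once for using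
weights at `β b` in the linear system, and once for storing its Hessian at `β (b + 1)` afterwards.
-/
theorem tracks_succ_of_isRenewable (h₀ : 0 < τ) (h₁ : τ < 1)
    (hG : GoodSample τ n x y β₀ c r κ q η) (hn : ∀ t, 0 < n t) (hκ : 0 < κ) (hr : 0 ≤ r)
    (hsmall : η + 2 * c ^ 2 * r * q ≤ min τ (1 - τ) * κ * r) {β : ℕ → 𝔼} {b : ℕ}
    (hb : Tracks τ n x y β₀ c r β b)
    (hstep : β (b + 1) = WithLp.toLp 2
      ((cumW τ n x y β b + batchW τ (n (b + 1)) (x (b + 1)) (y (b + 1)) (β b))⁻¹ *ᵥ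
      (cumW τ n x y β b *ᵥ (β b).ofLp + batchU τ (n (b + 1)) (x (b + 1)) (y (b + 1)) (β b)))) :
    Tracks τ n x y β₀ c r β (b + 1) := by
  have hc := hG.c_nonneg
  have ha : 0 < min τ (1 - τ) := lt_min h₀ (sub_pos.2 h₁)
  set M := cumW τ n x y β b + batchW τ (n (b + 1)) (x (b + 1)) (y (b + 1)) (β b) with hM
  have hform : ∀ u v : 𝔼, v.ofLp ⬝ᵥ (M *ᵥ u.ofLp) = cumForm τ n x y β b u v +
      ∑ i ∈ Finset.range (n (b + 1)), weight τ (y (b + 1) i - inner ℝ (x (b + 1) i) (β b)) *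
        inner ℝ (x (b + 1) i) u * inner ℝ (x (b + 1) i) v := fun u v => by
    rw [hM, Matrix.add_mulVec, dotProduct_add, dotProduct_cumW_mulVec, dotProduct_batchW_mulVec]
  have hlow : ∀ d : 𝔼, min τ (1 - τ) * cumSum n (fun t i => inner ℝ (x t i) d ^ 2) (b + 1) ≤
      d.ofLp ⬝ᵥ (M *ᵥ d.ofLp) := fun d => by
    rw [hform, cumSum_succ, mul_add]
    refine add_le_add (min_mul_cumSum_sq_le h₀ h₁ β b d) ?_
    rw [Finset.mul_sum]
    refine Finset.sum_le_sum fun i _ => ?_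
    rw [mul_assoc, ← sq]
    exact mul_le_mul_of_nonneg_right (min_le_weight h₀ h₁ _) (sq_nonneg _)
  -- Coercivity of the design makes `M` definite, so the inverse in the update is genuine and the
  -- update solves a linear system.
  have hunit : IsUnit M.det := by
    rw [isUnit_iff_ne_zero]
    intro hdet
    obtain ⟨u, hu0, hu⟩ := Matrix.exists_mulVec_eq_zero_iff.2 hdet
    have h1 := hlow (WithLp.toLp 2 u)
    have h2 := hG.design (b + 1) (WithLp.toLp 2 u)
    rw [WithLp.ofLp_toLp, hu, dotProduct_zero] at h1
    have h3 : 0 < ‖(WithLp.toLp 2 u : 𝔼)‖ :=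
      norm_pos_iff.2 fun h => hu0 (by simpa using congrArg WithLp.ofLp h)
    have hN := cumSum_one_pos hn (b + 1)
    have h4 : 0 < κ * cumSum n (fun _ _ => 1) (b + 1) * ‖(WithLp.toLp 2 u : 𝔼)‖ ^ 2 := by
      positivity
    exact absurd h1 (not_le.2 (mul_pos ha (h4.trans_le h2)))
  have hsolve : M *ᵥ (β (b + 1)).ofLp =
      cumW τ n x y β b *ᵥ (β b).ofLp + batchU τ (n (b + 1)) (x (b + 1)) (y (b + 1)) (β b) := by
    rw [hstep, WithLp.ofLp_toLp, Matrix.mulVec_mulVec, Matrix.mul_nonsing_inv _ hunit,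
      Matrix.one_mulVec]
  -- Subtracting `M β₀` turns the responses of the new batch into errors at `β₀`, still with the
  -- weights taken at `β b`.
  have hkey : ∀ v : 𝔼, v.ofLp ⬝ᵥ (M *ᵥ (β (b + 1) - β₀).ofLp) =
      cumForm τ n x y β b (β b - β₀) v + ∑ i ∈ Finset.range (n (b + 1)),
        weight τ (y (b + 1) i - inner ℝ (x (b + 1) i) (β b)) *
          (y (b + 1) i - inner ℝ (x (b + 1) i) β₀) * inner ℝ (x (b + 1) i) v := fun v => by
    rw [WithLp.ofLp_sub, Matrix.mulVec_sub, dotProduct_sub, hsolve, dotProduct_add,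
      dotProduct_cumW_mulVec, dotProduct_batchU, hform, cumForm_sub_left, add_sub_add_comm,
      ← Finset.sum_sub_distrib]
    congr 1
    refine Finset.sum_congr rfl fun i _ => ?_
    ring
  obtain ⟨hclose, herr⟩ := hb
  have hnear := near_batch_nonneg (n := n) (x := x) (y := y) (β₀ := β₀) (c := c) (r := r) (b + 1)
  have hfirst : ∀ v : 𝔼, |v.ofLp ⬝ᵥ (M *ᵥ (β (b + 1) - β₀).ofLp) -
      cumSum n (fun t i => weight τ (y t i - inner ℝ (x t i) β₀) *
        (y t i - inner ℝ (x t i) β₀) * inner ℝ (x t i) v) (b + 1)| ≤ 2 * c ^ 2 * r * ‖v‖ *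
      cumSum n (fun t i => if |y t i - inner ℝ (x t i) β₀| ≤ c * r then 1 else 0) b +
      c ^ 2 * r * ‖v‖ * ∑ i ∈ Finset.range (n (b + 1)),
        if |y (b + 1) i - inner ℝ (x (b + 1) i) β₀| ≤ c * r then 1 else 0 := fun v => by
    rw [hkey, cumSum_succ, add_sub_add_comm]
    exact (abs_add_le _ _).trans
      (add_le_add (herr v) (hG.abs_sum_weight_sub_mul_le h₀ h₁ hr (b + 1) hclose v))
  have hclose' : ‖β (b + 1) - β₀‖ ≤ r := by
    refine hG.norm_le_of_form_le hn ha hκ hr hsmall (b + 1) _ _ (hlow _) ((hfirst _).trans ?_)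
    rw [cumSum_succ, mul_add]
    nlinarith [show 0 ≤ c ^ 2 * r * ‖β (b + 1) - β₀‖ by positivity]
  refine ⟨hclose', fun v => ?_⟩
  have h2 := hG.abs_sum_weight_sub_weight_le h₀ h₁ hr (b + 1) hclose' hclose hclose' v
  have h3 := hfirst v
  rw [hform] at h3
  generalize cumSum n (fun t i => weight τ (y t i - inner ℝ (x t i) β₀) *
    (y t i - inner ℝ (x t i) β₀) * inner ℝ (x t i) v) (b + 1) = T at h3 ⊢
  rw [cumSum_succ, mul_add, cumForm, Finset.sum_range_succ, ← cumForm]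
  rw [abs_le] at *
  constructor <;> linarith

theorem norm_sub_le_of_isRenewable (h₀ : 0 < τ) (h₁ : τ < 1)
    (hG : GoodSample τ n x y β₀ c r κ q η) (hn : ∀ t, 0 < n t) (hκ : 0 < κ) (hr : 0 ≤ r)
    (hsmall : η + 2 * c ^ 2 * r * q ≤ min τ (1 - τ) * κ * r) {β : ℕ → 𝔼}
    (hβ : IsRenewable τ n x y β) (b : ℕ) : ‖β b - β₀‖ ≤ r := by
  suffices h : Tracks τ n x y β₀ c r β b from h.1
  induction b with
  | zero => exact tracks_zero h₀ h₁ hG hn hκ hr hsmall hβ.init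
  | succ b ih => exact tracks_succ_of_isRenewable h₀ h₁ hG hn hκ hr hsmall ih (hβ.step b)

theorem norm_sub_le_of_isRenewableArgmin (h₀ : 0 < τ) (h₁ : τ < 1)
    (hG : GoodSample τ n x y β₀ c r κ q η) (hn : ∀ t, 0 < n t) (hκ : 0 < κ) (hr : 0 ≤ r)
    (hsmall : η + 2 * c ^ 2 * r * q ≤ min τ (1 - τ) * κ * r) {β : ℕ → 𝔼}
    (hβ : IsRenewableArgmin τ n x y β) (b : ℕ) : ‖β b - β₀‖ ≤ r := by
  suffices h : Tracks τ n x y β₀ c r β b from h.1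
  induction b with
  | zero => exact tracks_zero h₀ h₁ hG hn hκ hr hsmall hβ.init
  | succ b ih => exact tracks_succ_of_isRenewableArgmin h₀ h₁ hG hn hκ hr hsmall ih (hβ.step b)

end GoodSample

end Good

/-! ### Laying the batches end to end -/

section Enumeration

/-- The enumeration of the observations, batch after batch. -/
def batchEnum (n : ℕ → ℕ) : ℕ → ℕ × ℕ
  | 0 => (0, 0)
  | j + 1 => if (batchEnum n j).2 + 1 < n (batchEnum n j).1
      then ((batchEnum n j).1, (batchEnum n j).2 + 1) else ((batchEnum n j).1 + 1, 0)

/-- Each step moves strictly up in the lexicographic order. Injectivity makes the reordered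
observations independent. -/
theorem batchEnum_injective (n : ℕ → ℕ) : Function.Injective (batchEnum n) := by
  have h : StrictMono fun j => toLex (batchEnum n j) := by
    refine strictMono_nat_of_lt_succ fun j => ?_
    rw [Prod.Lex.toLex_lt_toLex, batchEnum]
    split_ifs
    · exact Or.inr ⟨rfl, Nat.lt_succ_self _⟩
    · exact Or.inl (Nat.lt_succ_self _)
  exact fun i j hij => h.injective (congrArg toLex hij)

theorem batchEnum_sum_add {n : ℕ → ℕ} (hn : ∀ t, 0 < n t) (b i : ℕ) (hi : i < n b) :
    batchEnum n (∑ t ∈ Finset.range b, n t + i) = (b, i) := by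
  induction b generalizing i with
  | zero =>
    induction i with
    | zero => rfl
    | succ i ih =>
      rw [← add_assoc, batchEnum, ih (by omega), if_pos hi]
  | succ b ihb =>
    induction i with
    | zero =>
      -- The successor of the last observation of batch `b` opens batch `b + 1`; batch `b` must be
      -- nonempty to have a last observation.
      have h := ihb (n b - 1) (Nat.sub_lt (hn b) one_pos)
      have hb := hn b
      rw [Finset.sum_range_succ, add_zero,
        show ∑ t ∈ Finset.range b, n t + n b = ∑ t ∈ Finset.range b, n t + (n b - 1) + 1 by omega,
        batchEnum, h, if_neg (by simp only; omega)]
    | succ i ih =>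
      rw [← add_assoc, batchEnum, ih (by omega), if_pos hi]

theorem sum_batchEnum {n : ℕ → ℕ} (hn : ∀ t, 0 < n t) (g : ℕ × ℕ → ℝ) (b : ℕ) :
    ∑ j ∈ Finset.range (∑ t ∈ Finset.range b, n t), g (batchEnum n j) =
      ∑ t ∈ Finset.range b, ∑ i ∈ Finset.range (n t), g (t, i) := by
  induction b with
  | zero => simp
  | succ b ih =>
    rw [Finset.sum_range_succ, Finset.sum_range_add, ih, Finset.sum_range_succ]
    congr 1
    refine Finset.sum_congr rfl fun i hi => ?_
    rw [batchEnum_sum_add hn b i (Finset.mem_range.1 hi)]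

end Enumeration

/-! ### Law of large numbers, uniform over all long partial sums -/

section LawOfLargeNumbers

variable {Ω : Type*} [MeasurableSpace Ω] {μ : Measure Ω}

/-- Uniform law of large numbers: the averages of the first `N` terms of an independent and
identically distributed sequence, `N ≥ M`, are simultaneously close to the mean with probability
tending to `1` as `M → ∞`, uniformly over injective orderings of the variables. -/
theorem tendsto_measure_exists_deviation [IsProbabilityMeasure μ] {ι : Type*} {X : ι → Ω → ℝ}
    (hX : ∀ i, Measurable (X i))
    (hindep : iIndepFun X μ) (i₀ : ι) (hident : ∀ i, IdentDistrib (X i) (X i₀) μ μ)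
    (hint : Integrable (X i₀) μ) (e : ℕ → ℕ → ι) (he : ∀ k, Function.Injective (e k))
    (m : ℕ → ℕ) (hm : Tendsto m atTop atTop) {η : ℝ} (hη : 0 < η) :
    Tendsto (fun k => μ {ω | ∃ N : ℕ, m k ≤ N ∧
      η * N < |∑ j ∈ Finset.range N, X (e k j) ω - N * ∫ ω, X i₀ ω ∂μ|}) atTop (𝓝 0) := by
  set c := ∫ ω, X i₀ ω ∂μ with hc
  let B : ℕ → Set (ℕ → ℝ) := fun M =>
    {z | ∃ N : ℕ, M ≤ N ∧ η * N < |∑ j ∈ Finset.range N, z j - N * c|}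
  have : IsProbabilityMeasure (μ.map (X i₀)) :=
    Measure.isProbabilityMeasure_map (hX i₀).aemeasurable
  let Q : Measure (ℕ → ℝ) := Measure.infinitePi fun _ => μ.map (X i₀)
  have hB : ∀ M, MeasurableSet (B M) := fun M => by
    have : B M = ⋃ N : ℕ, ⋃ _ : M ≤ N, {z | η * N < |∑ j ∈ Finset.range N, z j - N * c|} := by
      ext z; simp [B]
    rw [this]
    refine MeasurableSet.iUnion fun N => MeasurableSet.iUnion fun _ => ?_
    refine measurableSet_lt measurable_const (Measurable.abs (Measurable.sub_const ?_ _))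
    exact Finset.measurable_sum _ fun j _ => measurable_pi_apply j
  -- The ordering changes with `k`, but the law of the reordered sequence does not. The probability
  -- at stage `k` is thus `Q (B (m k))`, and a single strong law suffices.
  have hlaw : ∀ k, μ.map (fun ω j => X (e k j) ω) = Q := fun k => by
    rw [(hindep.precomp (he k)).map_fun_eq_infinitePi_map fun j => hX _]
    congr 1
    funext j
    exact (hident _).map_eq
  have hmeas : ∀ k, Measurable fun ω j => X (e k j) ω := fun k =>
    measurable_pi_iff.2 fun j => hX _
  have hQ : Tendsto (fun M => Q (B M)) atTop (𝓝 0) := by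
    have hanti : Antitone B := fun M M' hMM z ⟨N, hN, h⟩ => ⟨N, hMM.trans hN, h⟩
    have hlim := tendsto_measure_iInter_atTop (μ := Q) (fun M => (hB M).nullMeasurableSet) hanti
      ⟨0, measure_ne_top _ _⟩
    suffices h : Q (⋂ M, B M) = 0 by rwa [h] at hlim
    -- Any ordering represents `Q`; the strong law is applied along `e 0`.
    rw [← hlaw 0, Measure.map_apply (hmeas 0) (MeasurableSet.iInter hB)]
    have hid : ∀ j, IdentDistrib (X (e 0 j)) (X (e 0 0)) μ μ := fun j =>
      (hident _).trans (hident _).symm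
    have hslln := strong_law_ae_real (fun j => X (e 0 j)) ((hident _).integrable_iff.2 hint)
      (fun i j hij => hindep.indepFun ((he 0).ne hij)) hid
    refine measure_mono_null (fun ω hω => ?_) (ae_iff.1 hslln)
    intro hlim
    rw [(hident (e 0 0)).integral_eq, ← hc, Metric.tendsto_atTop] at hlim
    obtain ⟨M, hM⟩ := hlim η hη
    -- `M + 1` rather than `M` ensures `N > 0` for the division.
    obtain ⟨N, hN, h⟩ := Set.mem_iInter.1 hω (M + 1)
    have hN0 : (0 : ℝ) < N := by exact_mod_cast (by omega : 0 < N)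
    have h1 := hM N (by omega)
    rw [Real.dist_eq, div_sub' hN0.ne', abs_div, abs_of_pos hN0, div_lt_iff₀ hN0] at h1
    exact absurd h h1.le.not_gt
  refine (hQ.comp hm).congr fun k => ?_
  rw [Function.comp_apply, ← hlaw k, Measure.map_apply (hmeas k) (hB _)]
  rfl

/-- The uniform law of large numbers along batches of growing first size. -/
theorem tendsto_measure_exists_cumSum_deviation [IsProbabilityMeasure μ] {S : Type*}
    [MeasurableSpace S] {Z : ℕ → ℕ → Ω → S}
    (hZ : ∀ t i, Measurable (Z t i))
    (hindep : iIndepFun (fun (ti : ℕ × ℕ) ω => Z ti.1 ti.2 ω) μ)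
    (hident : ∀ t i, IdentDistrib (Z t i) (Z 0 0) μ μ) {g : S → ℝ} (hg : Measurable g)
    (hint : Integrable (fun ω => g (Z 0 0 ω)) μ) (n : ℕ → ℕ → ℕ) (hn : ∀ k t, 0 < n k t)
    (hn₁ : Tendsto (fun k => n k 0) atTop atTop) {η : ℝ} (hη : 0 < η) :
    Tendsto (fun k => μ {ω | ∃ b, η * cumSum (n k) (fun _ _ => 1) b <
      |cumSum (n k) (fun t i => g (Z t i ω)) b -
        cumSum (n k) (fun _ _ => 1) b * ∫ ω, g (Z 0 0 ω) ∂μ|}) atTop (𝓝 0) := by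
  have h := tendsto_measure_exists_deviation (X := fun (ti : ℕ × ℕ) ω => g (Z ti.1 ti.2 ω))
    (fun ti => hg.comp (hZ _ _)) (hindep.comp (fun _ => g) fun _ => hg) (0, 0)
    (fun ti => (hident ti.1 ti.2).comp hg) hint (fun k => batchEnum (n k))
    (fun k => batchEnum_injective _) (fun k => n k 0) hn₁ hη
  refine tendsto_of_tendsto_of_tendsto_of_le_of_le tendsto_const_nhds h (fun _ => bot_le)
    fun k => measure_mono ?_
  rintro ω ⟨b, hb⟩
  -- The accumulated size is at least `n k 0` for every `b`, so one event covers all batch numbers,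
  -- whatever the later sizes.
  refine ⟨∑ t ∈ Finset.range (b + 1), n k t, ?_, ?_⟩
  · exact Finset.single_le_sum (f := fun t => n k t) (fun _ _ => Nat.zero_le _)
      (Finset.mem_range.2 (Nat.succ_pos b))
  · have h1 := sum_batchEnum (hn k) (fun ti => g (Z ti.1 ti.2 ω)) (b + 1)
    have h2 : cumSum (n k) (fun _ _ => 1) b = ((∑ t ∈ Finset.range (b + 1), n k t : ℕ) : ℝ) := by
      simp [cumSum]
    rw [h2] at hb
    simp only [h1]
    exact hb

theorem tendsto_measure_exists_cumSum_deviation_finite [IsProbabilityMeasure μ] {S : Type*}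
    [MeasurableSpace S] {Z : ℕ → ℕ → Ω → S}
    (hZ : ∀ t i, Measurable (Z t i))
    (hindep : iIndepFun (fun (ti : ℕ × ℕ) ω => Z ti.1 ti.2 ω) μ)
    (hident : ∀ t i, IdentDistrib (Z t i) (Z 0 0) μ μ) {ι : Type*} [Fintype ι] {g : ι → S → ℝ}
    (hg : ∀ a, Measurable (g a))
    (hint : ∀ a, Integrable (fun ω => g a (Z 0 0 ω)) μ) (n : ℕ → ℕ → ℕ) (hn : ∀ k t, 0 < n k t)
    (hn₁ : Tendsto (fun k => n k 0) atTop atTop) {η : ℝ} (hη : 0 < η) :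
    Tendsto (fun k => μ {ω | ∃ a, ∃ b, η * cumSum (n k) (fun _ _ => 1) b <
      |cumSum (n k) (fun t i => g a (Z t i ω)) b -
        cumSum (n k) (fun _ _ => 1) b * ∫ ω, g a (Z 0 0 ω) ∂μ|}) atTop (𝓝 0) := by
  have h := tendsto_finsetSum Finset.univ fun a _ =>
    tendsto_measure_exists_cumSum_deviation hZ hindep hident (hg a) (hint a) n hn hn₁ hη
  rw [Finset.sum_const_zero] at h
  refine tendsto_of_tendsto_of_tendsto_of_le_of_le tendsto_const_nhds h (fun _ => bot_le)
    fun k => ?_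
  rw [Set.ofPred_exists]
  exact measure_iUnion_fintype_le μ _

end LawOfLargeNumbers

/-! ### Centring of the score at the expectile -/

section Expectile

theorem integrable_id_of_integrable_sq {ν : Measure ℝ} [IsFiniteMeasure ν]
    (h : Integrable (fun e : ℝ => e ^ 2) ν) : Integrable (fun e : ℝ => e) ν :=
  ((memLp_two_iff_integrable_sq measurable_id.aestronglyMeasurable).2 h).integrable one_le_two

theorem measurable_rho (τ : ℝ) : Measurable (rho τ) := by
  have := measurable_weight τ
  unfold rho
  fun_prop

theorem abs_weight_mul_le {τ : ℝ} (h₀ : 0 < τ) (h₁ : τ < 1) (e : ℝ) : |weight τ e * e| ≤ |e| := by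
  rw [abs_mul, abs_of_nonneg (weight_nonneg e)]
  exact mul_le_of_le_one_left (abs_nonneg _) (weight_le_one h₀ h₁ e)

theorem rho_nonneg (τ u : ℝ) : 0 ≤ rho τ u := by
  have := weight_nonneg (τ := τ) u
  unfold rho; positivity

/-- The score of a law with finite second moment and `τ`-expectile `0` has mean zero. -/
theorem IsExpectile.integral_score_eq_zero {τ : ℝ} (h₀ : 0 < τ) (h₁ : τ < 1) {ν : Measure ℝ}
    [IsProbabilityMeasure ν] (h : IsExpectile τ ν 0) (hsq : Integrable (fun e : ℝ => e ^ 2) ν) :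
    ∫ e, weight τ e * e ∂ν = 0 := by
  have hψ : Integrable (fun e => weight τ e * e) ν :=
    (integrable_id_of_integrable_sq hsq).mono
      ((measurable_weight τ).mul measurable_id).aestronglyMeasurable
      (ae_of_all _ fun e => abs_weight_mul_le h₀ h₁ e)
  have hρ : Integrable (rho τ) ν := by
    refine hsq.mono (measurable_rho τ).aestronglyMeasurable (ae_of_all _ fun e => ?_)
    rw [Real.norm_of_nonneg (rho_nonneg τ e), Real.norm_of_nonneg (sq_nonneg e), rho]
    nlinarith [weight_le_one h₀ h₁ e, sq_nonneg e,
      mul_nonneg (sub_nonneg.2 (weight_le_one h₀ h₁ e)) (sq_nonneg e)]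
  rw [← neg_eq_zero]
  refine eq_zero_of_forall_nonneg (C := 1 / 2) fun s => ?_
  have hbound : ∀ e, rho τ (e - s) ≤ rho τ e - s * (weight τ e * e) + s ^ 2 / 2 := fun e => by
    have := rho_add_le h₀ h₁ e (-s)
    rw [← sub_eq_add_neg] at this
    linarith [this, show weight τ e * e * -s = - (s * (weight τ e * e)) by ring,
      show (-s) ^ 2 = s ^ 2 by ring]
  have hdiff : Integrable (fun e => rho τ e - s * (weight τ e * e)) ν := hρ.sub (hψ.const_mul s)
  have hint : Integrable (fun e => rho τ e - s * (weight τ e * e) + s ^ 2 / 2) ν :=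
    hdiff.add (integrable_const _)
  -- The shifted loss lies between zero and the integrable tangent parabola.
  have hint' : Integrable (fun e => rho τ (e - s)) ν := by
    refine hint.mono' ((measurable_rho τ).comp (measurable_id.sub_const s)).aestronglyMeasurable
      (ae_of_all _ fun e => ?_)
    rw [Real.norm_of_nonneg (rho_nonneg τ _)]
    exact hbound e
  have h2 := (h s).trans (integral_mono hint' hint hbound)
  rw [integral_add hdiff (integrable_const _),
    integral_sub hρ (hψ.const_mul s), integral_const_mul, integral_const, probReal_univ,
    one_smul] at h2
  simp only [sub_zero] at h2
  linarith

end Expectile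

/-! ### From conditional error laws to moments of the observations -/

section Moments

variable {p : ℕ} {Ω : Type*} [MeasurableSpace Ω] {μ : Measure Ω} [IsProbabilityMeasure μ]
  {X : Ω → EuclideanSpace ℝ (Fin p)} {Y : Ω → ℝ} {β₀ : EuclideanSpace ℝ (Fin p)}

instance (X : Ω → EuclideanSpace ℝ (Fin p)) (Y : Ω → ℝ) (β₀ : EuclideanSpace ℝ (Fin p)) :
    IsMarkovKernel (errorLaw μ X Y β₀) := by
  unfold errorLaw; infer_instance

theorem map_compProd_errorLaw (hX : Measurable X) (hY : Measurable Y) :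
    μ.map X ⊗ₘ errorLaw μ X Y β₀ = μ.map fun ω => (X ω, Y ω - inner ℝ (X ω) β₀) :=
  compProd_map_condDistrib (by fun_prop)

theorem integrable_sq_error (hX : Measurable X) (hY : Measurable Y) {c₁ : ℝ}
    (hmoment : ∀ᵐ v ∂(μ.map X), Integrable (fun e : ℝ => e ^ 2) (errorLaw μ X Y β₀ v) ∧
        ∫ e, e ^ 2 ∂(errorLaw μ X Y β₀ v) ≤ c₁) :
    Integrable (fun ω => (Y ω - inner ℝ (X ω) β₀) ^ 2) μ := by
  have : IsProbabilityMeasure (μ.map X) := Measure.isProbabilityMeasure_map hX.aemeasurable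
  have hm : Measurable fun z : EuclideanSpace ℝ (Fin p) × ℝ => z.2 ^ 2 := by fun_prop
  have h : Integrable (fun z : EuclideanSpace ℝ (Fin p) × ℝ => z.2 ^ 2)
      (μ.map X ⊗ₘ errorLaw μ X Y β₀) := by
    rw [Measure.integrable_compProd_iff hm.aestronglyMeasurable]
    refine ⟨hmoment.mono fun v hv => hv.1, ?_⟩
    refine Integrable.of_bound ?_ c₁ (hmoment.mono fun v hv => ?_)
    · exact (hm.norm.stronglyMeasurable.integral_kernel_prod_right'
        (κ := errorLaw μ X Y β₀)).aestronglyMeasurable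
    · rw [Real.norm_of_nonneg (integral_nonneg fun _ => norm_nonneg _)]
      simpa using hv.2
  rw [map_compProd_errorLaw hX hY] at h
  exact h.comp_measurable (by fun_prop : Measurable fun ω => (X ω, Y ω - inner ℝ (X ω) β₀))

theorem integrable_score_mul {τ : ℝ} (h₀ : 0 < τ) (h₁ : τ < 1) (hX : Measurable X)
    (hY : Measurable Y) {c : ℝ} (hbdd : ∀ᵐ ω ∂μ, ‖X ω‖ < c)
    (hsq : Integrable (fun ω => (Y ω - inner ℝ (X ω) β₀) ^ 2) μ) (j : Fin p) :
    Integrable (fun ω => weight τ (Y ω - inner ℝ (X ω) β₀) * (Y ω - inner ℝ (X ω) β₀) * X ω j)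
      μ := by
  have hm : Measurable fun ω => Y ω - inner ℝ (X ω) β₀ := by fun_prop
  have h1 : Integrable (fun ω => Y ω - inner ℝ (X ω) β₀) μ :=
    ((memLp_two_iff_integrable_sq hm.aestronglyMeasurable).2 hsq).integrable one_le_two
  have hw := measurable_weight τ
  refine (h1.mul_const c).mono (Measurable.aestronglyMeasurable ?_) (hbdd.mono fun ω hω => ?_)
  · exact ((hw.comp hm).mul hm).mul ((measurable_pi_apply j).comp
      ((WithLp.measurable_ofLp 2 _).comp hX))
  · rw [norm_mul, norm_mul _ c]
    refine mul_le_mul (abs_weight_mul_le h₀ h₁ _) ?_ (norm_nonneg _) (norm_nonneg _)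
    exact (PiLp.norm_apply_le (X ω) j).trans (hω.le.trans (le_abs_self c))

/-- Disintegrate along `X`: the regressor is constant in the inner integral, which is then a
multiple of the centred conditional score. -/
theorem integral_score_mul_eq_zero {τ : ℝ} (h₀ : 0 < τ) (h₁ : τ < 1) (hX : Measurable X)
    (hY : Measurable Y) {c c₁ : ℝ} (hbdd : ∀ᵐ ω ∂μ, ‖X ω‖ < c)
    (hexpectile : ∀ᵐ v ∂(μ.map X), IsExpectile τ (errorLaw μ X Y β₀ v) 0)
    (hmoment : ∀ᵐ v ∂(μ.map X), Integrable (fun e : ℝ => e ^ 2) (errorLaw μ X Y β₀ v) ∧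
        ∫ e, e ^ 2 ∂(errorLaw μ X Y β₀ v) ≤ c₁) (j : Fin p) :
    ∫ ω, weight τ (Y ω - inner ℝ (X ω) β₀) * (Y ω - inner ℝ (X ω) β₀) * X ω j ∂μ = 0 := by
  have : IsProbabilityMeasure (μ.map X) := Measure.isProbabilityMeasure_map hX.aemeasurable
  have hw := measurable_weight τ
  have hXY : Measurable fun ω => (X ω, Y ω - inner ℝ (X ω) β₀) := by fun_prop
  let F : EuclideanSpace ℝ (Fin p) × ℝ → ℝ := fun z => weight τ z.2 * z.2 * z.1 j
  have hF : Measurable F := by fun_prop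
  have hint : Integrable F (μ.map X ⊗ₘ errorLaw μ X Y β₀) := by
    rw [map_compProd_errorLaw hX hY, integrable_map_measure hF.aestronglyMeasurable
      hXY.aemeasurable]
    exact integrable_score_mul h₀ h₁ hX hY hbdd (integrable_sq_error hX hY hmoment) j
  have h1 : ∫ ω, F (X ω, Y ω - inner ℝ (X ω) β₀) ∂μ = ∫ z, F z ∂(μ.map X ⊗ₘ errorLaw μ X Y β₀) := by
    rw [map_compProd_errorLaw hX hY, integral_map hXY.aemeasurable hF.aestronglyMeasurable]
  refine h1.trans ?_
  rw [Measure.integral_compProd hint]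
  refine integral_eq_zero_of_ae ?_
  filter_upwards [hexpectile, hmoment] with v hv hv'
  simp only [F, integral_mul_const, hv.integral_score_eq_zero h₀ h₁ hv'.1, zero_mul, Pi.zero_apply]

theorem measure_error_eq_zero (hX : Measurable X) (hY : Measurable Y)
    (hac : ∀ᵐ v ∂(μ.map X), errorLaw μ X Y β₀ v {0} = 0) :
    μ {ω | Y ω - inner ℝ (X ω) β₀ = 0} = 0 := by
  have hXY : Measurable fun ω => (X ω, Y ω - inner ℝ (X ω) β₀) := by fun_prop
  have hS : MeasurableSet {z : EuclideanSpace ℝ (Fin p) × ℝ | z.2 = 0} :=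
    measurable_snd (measurableSet_singleton 0)
  have h : μ {ω | Y ω - inner ℝ (X ω) β₀ = 0} =
      μ.map (fun ω => (X ω, Y ω - inner ℝ (X ω) β₀)) {z | z.2 = 0} := by
    rw [Measure.map_apply hXY hS]; rfl
  rw [h, ← map_compProd_errorLaw hX hY, Measure.compProd_apply hS]
  exact (lintegral_congr_ae hac).trans lintegral_zero

/-- Errors without an atom at `0` are small with small probability. -/
theorem exists_measureReal_abs_le (hX : Measurable X) (hY : Measurable Y)
    (h0 : μ {ω | Y ω - inner ℝ (X ω) β₀ = 0} = 0) (c : ℝ) {R δ : ℝ} (hR : 0 < R) (hδ : 0 < δ) :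
    ∃ r, 0 < r ∧ r ≤ R ∧ μ.real {ω | |Y ω - inner ℝ (X ω) β₀| ≤ c * r} ≤ δ := by
  have hm : Measurable fun ω => Y ω - inner ℝ (X ω) β₀ := by fun_prop
  let r : ℕ → ℝ := fun k => R * (1 / (k + 1))
  -- `|c|` keeps the sets nested even for negative `c`; they shrink to the null event of a zero
  -- error.
  let A : ℕ → Set Ω := fun k => {ω | |Y ω - inner ℝ (X ω) β₀| ≤ |c| * r k}
  have hr : Antitone r := fun i j hij =>
    mul_le_mul_of_nonneg_left (Nat.one_div_le_one_div hij) hR.le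
  have hA : Antitone A := fun i j hij ω hω =>
    le_trans (show _ ≤ _ from hω) (mul_le_mul_of_nonneg_left (hr hij) (abs_nonneg c))
  have hrlim : Tendsto r atTop (𝓝 0) := by
    simpa [r] using tendsto_one_div_add_atTop_nhds_zero_nat.const_mul R
  have hlim := tendsto_measure_iInter_atTop (μ := μ)
    (fun k => (measurableSet_le hm.abs measurable_const : MeasurableSet (A k)).nullMeasurableSet)
    hA ⟨0, measure_ne_top _ _⟩
  have hnull : μ (⋂ k, A k) = 0 := by
    refine measure_mono_null (fun ω hω => ?_) h0
    have h1 := ge_of_tendsto' (hrlim.const_mul |c|) fun k => Set.mem_iInter.1 hω k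
    rw [mul_zero] at h1
    exact abs_eq_zero.1 (le_antisymm h1 (abs_nonneg _))
  rw [hnull] at hlim
  obtain ⟨k, hk⟩ := (hlim.eventually_lt_const (ENNReal.ofReal_pos.2 hδ)).exists
  have hrk : 0 < r k := by positivity
  refine ⟨r k, hrk, ?_, ?_⟩
  · simpa [r] using hr (Nat.zero_le k)
  · refine ENNReal.toReal_le_of_le_ofReal hδ.le ((measure_mono fun ω hω => ?_).trans hk.le)
    exact le_trans (show _ ≤ _ from hω) (mul_le_mul_of_nonneg_right (le_abs_self c) hrk.le)

end Moments

/-! ### Coercivity of the design and the criterion for a good sample -/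

section Design

variable {p : ℕ}

theorem dotProduct_mulVec_eq_sum (M : Matrix (Fin p) (Fin p) ℝ) (v : EuclideanSpace ℝ (Fin p)) :
    v.ofLp ⬝ᵥ (M *ᵥ v.ofLp) = ∑ j, ∑ l, v j * v l * M j l := by
  simp only [dotProduct, Matrix.mulVec, Finset.mul_sum]
  refine Finset.sum_congr rfl fun j _ => Finset.sum_congr rfl fun l _ => ?_
  ring

/-- A Hermitian matrix with positive eigenvalues is coercive. -/
theorem exists_pos_mul_norm_sq_le {M : Matrix (Fin p) (Fin p) ℝ} (hM : M.IsHermitian)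
    (hpos : ∀ j, 0 < hM.eigenvalues j) :
    ∃ κ : ℝ, 0 < κ ∧ ∀ v : EuclideanSpace ℝ (Fin p),
      κ * ‖v‖ ^ 2 ≤ ∑ j, ∑ l, v j * v l * M j l := by
  have hPD := hM.posDef_iff_eigenvalues_pos.2 hpos
  let f : EuclideanSpace ℝ (Fin p) → ℝ := fun v => ∑ j, ∑ l, v j * v l * M j l
  have hf : Continuous f := by fun_prop
  have hfpos : ∀ v, v ≠ 0 → 0 < f v := fun v hv => by
    have := hPD.dotProduct_mulVec_pos (x := v.ofLp) fun h => hv (by ext j; simp [h])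
    rwa [star_trivial, dotProduct_mulVec_eq_sum] at this
  have hsmul : ∀ (s : ℝ) v, f (s • v) = s ^ 2 * f v := fun s v => by
    simp only [f, PiLp.smul_apply, smul_eq_mul, Finset.mul_sum]
    refine Finset.sum_congr rfl fun j _ => Finset.sum_congr rfl fun l _ => ?_
    ring
  -- The sphere is empty when `p = 0`; otherwise the constant is the minimum of the form on it.
  rcases (Metric.sphere (0 : EuclideanSpace ℝ (Fin p)) 1).eq_empty_or_nonempty with he | hne
  · refine ⟨1, one_pos, fun v => ?_⟩
    have hv : v = 0 := by
      by_contra hv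
      have : ‖v‖⁻¹ • v ∈ Metric.sphere (0 : EuclideanSpace ℝ (Fin p)) 1 := by
        rw [mem_sphere_zero_iff_norm, norm_smul, norm_inv, norm_norm,
          inv_mul_cancel₀ (norm_ne_zero_iff.2 hv)]
      rw [he] at this
      exact this
    simp [hv]
  · obtain ⟨u, hu, hmin⟩ := (isCompact_sphere _ _).exists_isMinOn hne hf.continuousOn
    rw [mem_sphere_zero_iff_norm] at hu
    refine ⟨f u, hfpos u fun h => by simp [h] at hu, fun v => ?_⟩
    rcases eq_or_ne v 0 with rfl | hv
    · simp
    have hv' := norm_ne_zero_iff.2 hv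
    have h1 : f u ≤ f (‖v‖⁻¹ • v) := hmin (by
      rw [mem_sphere_zero_iff_norm, norm_smul, norm_inv, norm_norm, inv_mul_cancel₀ hv'])
    calc f u * ‖v‖ ^ 2 ≤ f (‖v‖⁻¹ • v) * ‖v‖ ^ 2 := by gcongr
      _ = f v := by rw [hsmul]; field_simp

theorem inner_eq_sum_apply (u v : EuclideanSpace ℝ (Fin p)) : inner ℝ u v = ∑ j, v j * u j := by
  simp [PiLp.inner_apply]

theorem cumSum_sum {ι : Type*} (s : Finset ι) (n : ℕ → ℕ) (g : ι → ℕ → ℕ → ℝ) (b : ℕ) :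
    cumSum n (fun t i => ∑ a ∈ s, g a t i) b = ∑ a ∈ s, cumSum n (g a) b := by
  simp only [cumSum]
  rw [Finset.sum_comm]
  refine Finset.sum_congr rfl fun t _ => ?_
  rw [Finset.sum_comm]

theorem cumSum_const_mul (n : ℕ → ℕ) (c : ℝ) (g : ℕ → ℕ → ℝ) (b : ℕ) :
    cumSum n (fun t i => c * g t i) b = c * cumSum n g b := by
  simp only [cumSum, Finset.mul_sum]

/-- A sample is good if the averages of the products of the regressors, of the scores and of the
indicators of small errors are close to their means. -/
theorem goodSample_of_forall_deviation_le {τ : ℝ} {n : ℕ → ℕ}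
    {x : ℕ → ℕ → EuclideanSpace ℝ (Fin p)} {y : ℕ → ℕ → ℝ} {β₀ : EuclideanSpace ℝ (Fin p)}
    {c r κ δ P : ℝ} {M : Matrix (Fin p) (Fin p) ℝ} (hx : ∀ t i, ‖x t i‖ ≤ c)
    (hM : ∀ v : EuclideanSpace ℝ (Fin p),
      (κ + p ^ 2 * δ) * ‖v‖ ^ 2 ≤ ∑ j, ∑ l, v j * v l * M j l)
    (hdesign : ∀ j l b, |cumSum n (fun t i => x t i j * x t i l) b -
      cumSum n (fun _ _ => 1) b * M j l| ≤ δ * cumSum n (fun _ _ => 1) b)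
    (hscore : ∀ j b, |cumSum n (fun t i => weight τ (y t i - inner ℝ (x t i) β₀) *
      (y t i - inner ℝ (x t i) β₀) * x t i j) b| ≤ δ * cumSum n (fun _ _ => 1) b)
    (hnear : ∀ b, |cumSum n (fun t i => if |y t i - inner ℝ (x t i) β₀| ≤ c * r then 1 else 0) b -
      cumSum n (fun _ _ => 1) b * P| ≤ δ * cumSum n (fun _ _ => 1) b) :
    GoodSample τ n x y β₀ c r κ (P + δ) (p * δ) := by
  refine ⟨hx, fun b v => ?_, fun b => ?_, fun b v => ?_⟩
  · have h1 : cumSum n (fun t i => inner ℝ (x t i) v ^ 2) b =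
        ∑ j, ∑ l, v j * v l * cumSum n (fun t i => x t i j * x t i l) b := by
      simp only [← cumSum_const_mul, ← cumSum_sum]
      congr 1
      funext t i
      rw [inner_eq_sum_apply, sq, Finset.sum_mul_sum]
      refine Finset.sum_congr rfl fun j _ => Finset.sum_congr rfl fun l _ => ?_
      ring
    have hd := fun j l => hdesign j l b
    have hN : 0 ≤ cumSum n (fun _ _ => (1 : ℝ)) b :=
      Finset.sum_nonneg fun _ _ => Finset.sum_nonneg fun _ _ => zero_le_one
    generalize cumSum n (fun _ _ => (1 : ℝ)) b = N at hd hN ⊢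
    rw [h1]
    -- Each of the `p ^ 2` entries costs at most `δ * N * ‖v‖ ^ 2`, the reserve built into `hM`.
    have h2 : N * ∑ j, ∑ l, v j * v l * M j l - ∑ _j : Fin p, ∑ _l : Fin p, ‖v‖ ^ 2 * (δ * N) ≤
        ∑ j, ∑ l, v j * v l * cumSum n (fun t i => x t i j * x t i l) b := by
      rw [Finset.mul_sum, ← Finset.sum_sub_distrib]
      refine Finset.sum_le_sum fun j _ => ?_
      rw [Finset.mul_sum, ← Finset.sum_sub_distrib]
      refine Finset.sum_le_sum fun l _ => ?_
      have h3 : |v j * v l * (cumSum n (fun t i => x t i j * x t i l) b - N * M j l)| ≤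
          ‖v‖ ^ 2 * (δ * N) := by
        rw [abs_mul, abs_mul, sq]
        exact mul_le_mul (mul_le_mul (PiLp.norm_apply_le v j) (PiLp.norm_apply_le v l)
          (abs_nonneg _) (norm_nonneg _)) (hd j l) (abs_nonneg _) (by positivity)
      linarith [(abs_le.1 h3).1]
    refine le_trans ?_ h2
    have h4 := mul_le_mul_of_nonneg_left (hM v) hN
    simp only [Finset.sum_const, Finset.card_univ, Fintype.card_fin, nsmul_eq_mul]
    linarith
  · linarith [(abs_le.1 (hnear b)).2]
  · have h1 : cumSum n (fun t i => weight τ (y t i - inner ℝ (x t i) β₀) *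
        (y t i - inner ℝ (x t i) β₀) * inner ℝ (x t i) v) b =
        ∑ j, v j * cumSum n (fun t i => weight τ (y t i - inner ℝ (x t i) β₀) *
        (y t i - inner ℝ (x t i) β₀) * x t i j) b := by
      simp only [← cumSum_const_mul, ← cumSum_sum]
      congr 1
      funext t i
      rw [inner_eq_sum_apply (x t i) v, Finset.mul_sum]
      refine Finset.sum_congr rfl fun j _ => ?_
      ring
    rw [h1]
    refine (Finset.abs_sum_le_sum_abs _ _).trans ?_
    calc _ ≤ ∑ _j : Fin p, ‖v‖ * (δ * cumSum n (fun _ _ => 1) b) :=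
          Finset.sum_le_sum fun j _ => by
            rw [abs_mul]
            exact mul_le_mul (PiLp.norm_apply_le v j) (hscore j b) (abs_nonneg _) (norm_nonneg _)
      _ = _ := by
        simp only [Finset.sum_const, Finset.card_univ, Fintype.card_fin, nsmul_eq_mul]; ring

end Design

/-! ### Choice of constants and conclusion -/

variable {p : ℕ} {Ω : Type*} [MeasurableSpace Ω] {μ : Measure Ω} [IsProbabilityMeasure μ]

/-- With probability tending to `1` as the size of the first batch grows, the sample is good at
any prescribed scale, with constants that keep the estimates at that scale. -/
theorem exists_tendsto_measure_not_goodSample {τ : ℝ} (h₀ : 0 < τ) (h₁ : τ < 1)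
    {x : ℕ → ℕ → Ω → EuclideanSpace ℝ (Fin p)} {y : ℕ → ℕ → Ω → ℝ}
    (hx : ∀ t i, Measurable (x t i)) (hy : ∀ t i, Measurable (y t i))
    (hindep : iIndepFun (fun (ti : ℕ × ℕ) ω => (x ti.1 ti.2 ω, y ti.1 ti.2 ω)) μ)
    (hident : ∀ t i, IdentDistrib (fun ω => (x t i ω, y t i ω)) (fun ω => (x 0 0 ω, y 0 0 ω)) μ μ)
    {β₀ : EuclideanSpace ℝ (Fin p)} {c₁ c : ℝ}
    (hexpectile : ∀ᵐ v ∂(μ.map (x 0 0)), IsExpectile τ (errorLaw μ (x 0 0) (y 0 0) β₀ v) 0)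
    (hmoment : ∀ᵐ v ∂(μ.map (x 0 0)),
      Integrable (fun e : ℝ => e ^ 2) (errorLaw μ (x 0 0) (y 0 0) β₀ v) ∧
        ∫ e, e ^ 2 ∂(errorLaw μ (x 0 0) (y 0 0) β₀ v) ≤ c₁)
    (hdesign : ∀ j, 0 < (secondMoment_isHermitian μ (x 0 0)).eigenvalues j)
    (hatom : ∀ᵐ v ∂(μ.map (x 0 0)), errorLaw μ (x 0 0) (y 0 0) β₀ v {0} = 0)
    (hbounded : ∀ t i, ∀ᵐ ω ∂μ, ‖x t i ω‖ < c)
    (n : ℕ → ℕ → ℕ) (hn : ∀ k t, 0 < n k t) (hn₁ : Tendsto (fun k => n k 0) atTop atTop)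
    {R : ℝ} (hR : 0 < R) :
    ∃ r κ q η : ℝ, 0 < r ∧ r ≤ R ∧ 0 < κ ∧ η + 2 * c ^ 2 * r * q ≤ min τ (1 - τ) * κ * r ∧
      Tendsto (fun k => μ {ω | ¬ GoodSample τ (n k) (fun t i => x t i ω) (fun t i => y t i ω)
        β₀ c r κ q η}) atTop (𝓝 0) := by
  have ha : 0 < min τ (1 - τ) := lt_min h₀ (sub_pos.2 h₁)
  set a := min τ (1 - τ)
  obtain ⟨κ₀, hκ₀, hcoer⟩ := exists_pos_mul_norm_sq_le _ hdesign
  -- The budget is `a * (κ₀ / 2) * r`. The radius comes first: it keeps the expected small-error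
  -- term `2 * c ^ 2 * r * P` within half the budget.
  obtain ⟨r, hr, hrR, hP⟩ := exists_measureReal_abs_le (hx 0 0) (hy 0 0)
    (measure_error_eq_zero (β₀ := β₀) (hx 0 0) (hy 0 0) hatom) c hR
    (show 0 < a * κ₀ / (8 * (c ^ 2 + 1)) by positivity)
  set P := μ.real {ω | |y 0 0 ω - inner ℝ (x 0 0 ω) β₀| ≤ c * r} with hPdef
  -- With `r` fixed, the sampling tolerance `δ` spends the other half of the budget (first term) and
  -- at most half of the coercivity constant `κ₀` (second term).
  let δ := min (a * κ₀ * r / (4 * (p + 2 * c ^ 2 * r + 1))) (κ₀ / (2 * (p ^ 2 + 1)))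
  have hδ : 0 < δ := lt_min (by positivity) (by positivity)
  have hδ₁ : (p + 2 * c ^ 2 * r) * δ ≤ a * κ₀ * r / 4 := by
    have h : δ ≤ a * κ₀ * r / (4 * (p + 2 * c ^ 2 * r + 1)) := min_le_left _ _
    rw [le_div_iff₀ (by positivity)] at h
    nlinarith
  have hδ₂ : p ^ 2 * δ ≤ κ₀ / 2 := by
    have h : δ ≤ κ₀ / (2 * (p ^ 2 + 1)) := min_le_right _ _
    rw [le_div_iff₀ (by positivity)] at h
    nlinarith
  have hP' : 2 * c ^ 2 * r * P ≤ a * κ₀ * r / 4 := by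
    rw [le_div_iff₀ (by positivity)] at hP
    have hP0 : 0 ≤ P := measureReal_nonneg
    have h : c ^ 2 * P ≤ a * κ₀ / 8 := by nlinarith
    nlinarith
  refine ⟨r, κ₀ / 2, P + δ, p * δ, hr, hrR, by positivity, by linarith, ?_⟩
  -- Finitely many coordinate functions suffice, since the bounds for all directions `v` follow by
  -- linearity.
  let g : (Fin p × Fin p) ⊕ (Fin p ⊕ Unit) → EuclideanSpace ℝ (Fin p) × ℝ → ℝ :=
    Sum.elim (fun jl z => z.1 jl.1 * z.1 jl.2) (Sum.elim
      (fun j z => weight τ (z.2 - inner ℝ z.1 β₀) * (z.2 - inner ℝ z.1 β₀) * z.1 j)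
      (fun _ z => if |z.2 - inner ℝ z.1 β₀| ≤ c * r then 1 else 0))
  have hw := measurable_weight τ
  have hset : MeasurableSet {z : EuclideanSpace ℝ (Fin p) × ℝ |
      |z.2 - inner ℝ z.1 β₀| ≤ c * r} := measurableSet_le (by fun_prop) (by fun_prop)
  have hg : ∀ s, Measurable (g s) := by
    rintro (jl | j | _)
    · simp only [g, Sum.elim_inl]; fun_prop
    · simp only [g, Sum.elim_inl, Sum.elim_inr]; fun_prop
    · exact Measurable.ite hset measurable_const measurable_const
  have hint : ∀ s, Integrable (fun ω => g s (x 0 0 ω, y 0 0 ω)) μ := by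
    have hxy : Measurable fun ω => (x 0 0 ω, y 0 0 ω) := (hx 0 0).prodMk (hy 0 0)
    rintro (jl | j | u)
    · refine Integrable.of_bound ((hg (.inl jl)).comp hxy).aestronglyMeasurable (c * c)
        ((hbounded 0 0).mono fun ω hω => ?_)
      have hj := fun j => (PiLp.norm_apply_le (x 0 0 ω) j).trans hω.le
      simp only [g, Sum.elim_inl, norm_mul]
      exact mul_le_mul (hj _) (hj _) (norm_nonneg _) ((norm_nonneg _).trans hω.le)
    · exact integrable_score_mul h₀ h₁ (hx 0 0) (hy 0 0) (hbounded 0 0)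
        (integrable_sq_error (hx 0 0) (hy 0 0) hmoment) j
    · refine Integrable.of_bound ((hg (.inr (.inr u))).comp hxy).aestronglyMeasurable 1
        (ae_of_all _ fun ω => ?_)
      simp only [g, Sum.elim_inr]
      split_ifs <;> simp
  have hmean_near : ∫ ω, g (.inr (.inr ())) (x 0 0 ω, y 0 0 ω) ∂μ = P := by
    have hs : MeasurableSet {ω | |y 0 0 ω - inner ℝ (x 0 0 ω) β₀| ≤ c * r} :=
      ((hx 0 0).prodMk (hy 0 0)) hset
    rw [hPdef, ← integral_indicator_one hs]
    rfl
  have hlln := tendsto_measure_exists_cumSum_deviation_finite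
    (Z := fun t i ω => (x t i ω, y t i ω)) (fun t i => (hx t i).prodMk (hy t i)) hindep hident
    hg hint n hn hn₁ hδ
  refine tendsto_of_tendsto_of_tendsto_of_le_of_le tendsto_const_nhds hlln (fun _ => bot_le)
    fun k => measure_mono_ae ?_
  have hbdd : ∀ᵐ ω ∂μ, ∀ t i, ‖x t i ω‖ < c := ae_all_iff.2 fun t => ae_all_iff.2 (hbounded t)
  filter_upwards [hbdd] with ω hω
  refine fun hbad => by_contra fun hdev => hbad ?_
  have hdev' : ∀ s b, |cumSum (n k) (fun t i => g s (x t i ω, y t i ω)) b -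
      cumSum (n k) (fun _ _ => 1) b * ∫ ω, g s (x 0 0 ω, y 0 0 ω) ∂μ| ≤
      δ * cumSum (n k) (fun _ _ => 1) b :=
    fun s b => not_lt.1 fun h => hdev ⟨s, b, h⟩
  refine goodSample_of_forall_deviation_le (M := secondMoment μ (x 0 0)) (fun t i => (hω t i).le)
    (fun v => le_trans (mul_le_mul_of_nonneg_right (by linarith) (sq_nonneg _)) (hcoer v))
    (fun j l b => hdev' (.inl (j, l)) b) (fun j b => ?_) fun b => ?_
  · have h := hdev' (.inr (.inl j)) b
    have hmean : ∫ ω, g (.inr (.inl j)) (x 0 0 ω, y 0 0 ω) ∂μ = 0 :=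
      integral_score_mul_eq_zero h₀ h₁ (hx 0 0) (hy 0 0) (hbounded 0 0) hexpectile hmoment j
    rw [hmean, mul_zero, sub_zero] at h
    exact h
  · have h := hdev' (.inr (.inr ())) b
    rw [hmean_near] at h
    exact h

end ReER

theorem theorem1 {Ω : Type*} [MeasurableSpace Ω] (μ : Measure Ω) [IsProbabilityMeasure μ]
    (p : ℕ) (τ : ℝ) (hτ₀ : 0 < τ) (hτ₁ : τ < 1)
    -- the observations `(x t i, y t i)`, independent and identically distributed over `t` and `i`
    (x : ℕ → ℕ → Ω → EuclideanSpace ℝ (Fin p)) (y : ℕ → ℕ → Ω → ℝ)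
    (hx : ∀ t i, Measurable (x t i)) (hy : ∀ t i, Measurable (y t i))
    (hindep : iIndepFun (fun (ti : ℕ × ℕ) ω => (x ti.1 ti.2 ω, y ti.1 ti.2 ω)) μ)
    (hident : ∀ t i, IdentDistrib (fun ω => (x t i ω, y t i ω)) (fun ω => (x 0 0 ω, y 0 0 ω)) μ μ)
    -- (C1)
    (H : Set (EuclideanSpace ℝ (Fin p))) (hHcompact : IsCompact H) (hHconvex : Convex ℝ H)
    (β₀ : EuclideanSpace ℝ (Fin p)) (hβ₀ : β₀ ∈ interior H)
    (c₁ c₂ c₃ c₄ : ℝ)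
    -- (C2)
    (hexpectile : ∀ t i, ∀ᵐ v ∂(μ.map (x t i)),
      ReER.IsExpectile τ (ReER.errorLaw μ (x t i) (y t i) β₀ v) 0)
    (hmoment : ∀ t i, ∀ᵐ v ∂(μ.map (x t i)),
      Integrable (fun e : ℝ => e ^ 2) (ReER.errorLaw μ (x t i) (y t i) β₀ v) ∧
        ∫ e, e ^ 2 ∂(ReER.errorLaw μ (x t i) (y t i) β₀ v) ≤ c₁)
    -- (C3)
    (hdesign : ∀ t i j, 0 < (ReER.secondMoment_isHermitian μ (x t i)).eigenvalues j ∧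
      (ReER.secondMoment_isHermitian μ (x t i)).eigenvalues j ≤ c₂)
    -- (C4)
    (hdensity : ∀ t i, ∀ᵐ v ∂(μ.map (x t i)), ∃ f : ℝ → ℝ, Measurable f ∧
      ReER.errorLaw μ (x t i) (y t i) β₀ v = volume.withDensity (fun e => ENNReal.ofReal (f e)) ∧
      ∀ e, 0 < f e ∧ f e ≤ c₃)
    -- (C5): `n k t` is the size of batch `t` at stage `k` of the asymptotics
    (hbounded : ∀ t i, ∀ᵐ ω ∂μ, ‖x t i ω‖ < c₄)
    (n : ℕ → ℕ → ℕ) (hn : ∀ k t, 0 < n k t) (hn₁ : Tendsto (fun k => n k 0) atTop atTop)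
    -- the batch whose estimate is considered at stage `k`
    (b : ℕ → ℕ) :
    (∀ β : ℕ → ℕ → Ω → EuclideanSpace ℝ (Fin p),
      (∀ k, ∀ᵐ ω ∂μ, ReER.IsRenewable τ (n k) (fun t i => x t i ω) (fun t i => y t i ω)
        (fun t => β k t ω)) →
      TendstoInMeasure μ (fun k => β k (b k)) atTop (fun _ => β₀)) ∧
    (∀ β : ℕ → ℕ → Ω → EuclideanSpace ℝ (Fin p),
      (∀ k, ∀ᵐ ω ∂μ, ReER.IsRenewableArgmin τ (n k) (fun t i => x t i ω) (fun t i => y t i ω)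
        (fun t => β k t ω)) →
      TendstoInMeasure μ (fun k => β k (b k)) atTop (fun _ => β₀)) := by
  have hatom : ∀ᵐ v ∂(μ.map (x 0 0)), ReER.errorLaw μ (x 0 0) (y 0 0) β₀ v {0} = 0 := by
    filter_upwards [hdensity 0 0] with v hv
    obtain ⟨f, -, hf, -⟩ := hv
    rw [hf]
    exact withDensity_absolutelyContinuous _ _ (measure_singleton 0)
  -- The bound is pathwise on the good event, so the estimates need not be measurable and `b k` may
  -- be arbitrary.
  have key : ∀ β : ℕ → ℕ → Ω → EuclideanSpace ℝ (Fin p),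
      (∀ k, ∀ᵐ ω ∂μ, ∀ r κ q η : ℝ, 0 ≤ r → 0 < κ →
        η + 2 * c₄ ^ 2 * r * q ≤ min τ (1 - τ) * κ * r →
        ReER.GoodSample τ (n k) (fun t i => x t i ω) (fun t i => y t i ω) β₀ c₄ r κ q η →
        ‖β k (b k) ω - β₀‖ ≤ r) →
      TendstoInMeasure μ (fun k => β k (b k)) atTop (fun _ => β₀) := by
    intro β hβ
    rw [tendstoInMeasure_iff_norm]
    intro ε hε
    obtain ⟨r, κ, q, η, hr, hrε, hκ, hsmall, hlim⟩ :=
      ReER.exists_tendsto_measure_not_goodSample hτ₀ hτ₁ hx hy hindep hident (hexpectile 0 0)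
        (hmoment 0 0) (fun j => (hdesign 0 0 j).1) hatom hbounded n hn hn₁ (half_pos hε)
    refine tendsto_of_tendsto_of_tendsto_of_le_of_le tendsto_const_nhds hlim (fun _ => bot_le)
      fun k => measure_mono_ae ?_
    filter_upwards [hβ k] with ω hω
    intro hfar hgood
    have hnear := hω r κ q η hr.le hκ hsmall hgood
    have hfar' : ε ≤ ‖β k (b k) ω - β₀‖ := hfar
    linarith
  refine ⟨fun β hβ => key β fun k => (hβ k).mono fun ω hω r κ q η hr hκ hsmall hgood => ?_,
    fun β hβ => key β fun k => (hβ k).mono fun ω hω r κ q η hr hκ hsmall hgood => ?_⟩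
  · exact hgood.norm_sub_le_of_isRenewable hτ₀ hτ₁ (hn k) hκ hr hsmall hω (b k)
  · exact hgood.norm_sub_le_of_isRenewableArgmin hτ₀ hτ₁ (hn k) hκ hr hsmall hω (b k)
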